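/- Let $p$ be an odd prime, let $B_{2p}$ be the braid group with standard generators $\sigma_1,\dots,\sigma_{2p-1}$, and let braids act on the free group $F_{2p}=\langle y_1,\dots,y_{2p}\rangle$ from the right ($\beta\beta'$ acts as $\beta$ followed by $\beta'$) by the Artin representation: $\sigma_i(y_i)=y_iy_{i+1}y_i^{-1}$, $\sigma_i(y_{i+1})=y_i$, and $\sigma_i(y_j)=y_j$ otherwise. Put $$\rho_0=\sigma_{p-1}\sigma_{p-2}\cdots\sigma_1,\qquad \tau=(\sigma_2\sigma_4\cdots\sigma_{2p-2})(\sigma_3\sigma_5\cdots\sigma_{2p-3})\cdots(\sigma_{p-1}\sigma_{p+1})(\sigma_p),\qquad \rho_1=\tau^{-1}\sigma_1\sigma_3\cdots\sigma_{2p-1}\tau,$$ and $\eta(\gamma_1)=\rho_0^{\,p}$, $\eta(\gamma_{12:r})=\rho_0^{\,r-p}\rho_1^2\rho_0^{\,p-r}$ for $1\le r\le p$. Let $u_r=y_1y_2\cdots y_{2r}$ and $v_r=y_{2r-1}$ for $1\le r\le p$; these elements freely generate $F_{2p}$. Let $G=G(\mathsf{d}\mathcal{A}_p)$ be the group (the fundamental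 group of the complement of the decone, with respect to the line $x_2=0$, of the arrangement $x_1x_2(x_1^p-x_2^p)(x_1^p-x_3^p)(x_2^p-x_3^p)=0$) given by the presentation with the $3p+1$ generators $\gamma_1,\gamma_{12:1},\dots,\gamma_{12:p},u_1,\dots,u_p,v_1,\dots,v_p$ and the $2p(p+1)$ relations $$x\,\gamma=\gamma\cdot(\tau\,\eta(\gamma)\,\tau^{-1})(x),\qquad \gamma\in\{\gamma_1,\gamma_{12:1},\dots,\gamma_{12:p}\},\quad x\in\{u_1,\dots,u_p,v_1,\dots,v_p\},$$ where $(\tau\eta(\gamma)\tau^{-1})(x)$ is written as a word in the $u_r$ and $v_r$. Let $\mathbf{A}$ be the $2p(p+1)\times(3p+1)$ Alexander matrix of this presentation, that is, the matrix of Fox derivatives of the relators, with entries in $\mathbb{Z}[G^{\mathrm{ab}}]$, and let $\mathbf{A}(2)$ be the integer matrix obtained by evaluating $\mathbf{A}$ at the character $\mathbf{t}(2)\colon G\to\{\pm1\}$ with $\gamma_1\mapsto-1$, $\gamma_{12:r}\mapsto 1$, $y_i\mapsto-1$ (so $u_r\mapsto1$, $v_r\mapsto-1$). Then the nonzero diagonal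 entries of the Smith normal form of $\mathbf{A}(2)$ over $\mathbb{Z}$ are $2,\dots,2$ (repeated $3p-1$ times) and $2p$; that is, there are integer matrices $U,V$, invertible over $\mathbb{Z}$, such that $U\mathbf{A}(2)V$ is the rectangular diagonal matrix with diagonal $2,\dots,2,2p,0$. -/

import Mathlib

/-! ### Smith normal form over the integers -/

/-- The `M × N` matrix with the entries of `d` down the main diagonal and zeros elsewhere. -/
def rectDiagonal (M N : ℕ) (d : List ℤ) : Matrix (Fin M) (Fin N) ℤ :=
  Matrix.of fun i j => if i.val = j.val then d.getD i.val 0 else 0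

/-- `A` has an integral Smith normal form whose nonzero diagonal entries are, in order, the
entries of `d`: these are positive, each divides the following ones, they fit on the diagonal,
and, for all enumerations of the rows and columns, `A` can be brought to the rectangular diagonal
matrix of `d` (completed by zeros) by multiplying with invertible integer matrices
on the left and on the right. -/
def HasSmithNormalForm {m n : Type*} [Fintype m] [Fintype n] (A : Matrix m n ℤ)
    (d : List ℤ) : Prop :=
  (∀ x ∈ d, 0 < x) ∧ d.Pairwise (· ∣ ·) ∧
  d.length ≤ Fintype.card m ∧ d.length ≤ Fintype.card n ∧
  ∀ (er : m ≃ Fin (Fintype.card m)) (ec : n ≃ Fin (Fintype.card n)),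
    ∃ (U : Matrix (Fin (Fintype.card m)) (Fin (Fintype.card m)) ℤ)
      (V : Matrix (Fin (Fintype.card n)) (Fin (Fintype.card n)) ℤ),
      IsUnit U ∧ IsUnit V ∧
        U * Matrix.reindex er ec A * V = rectDiagonal (Fintype.card m) (Fintype.card n) d

/-! ### Fox calculus and Alexander matrices -/

namespace Fox

variable {α : Type*} [DecidableEq α]

/-- The free derivative on (not necessarily reduced) words; `(y, true)` stands for the letter `y`
and `(y, false)` for `y⁻¹`. -/
noncomputable def derivWord (x : α) : List (α × Bool) → MonoidAlgebra ℤ (FreeGroup α)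
  | [] => 0
  | (y, true) :: L =>
      (if y = x then 1 else 0) + MonoidAlgebra.of ℤ _ (FreeGroup.of y) * derivWord x L
  | (y, false) :: L =>
      (if y = x then -MonoidAlgebra.of ℤ _ (FreeGroup.of y)⁻¹ else 0)
        + MonoidAlgebra.of ℤ _ (FreeGroup.of y)⁻¹ * derivWord x L

theorem derivWord_append (x : α) (L₁ L₂ : List (α × Bool)) :
    derivWord x (L₁ ++ L₂) =
      derivWord x L₁ + MonoidAlgebra.of ℤ _ (FreeGroup.mk L₁) * derivWord x L₂ := by
  induction L₁ with
  | nil =>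
    have h : (FreeGroup.mk ([] : List (α × Bool))) = 1 := rfl
    rw [h, map_one, one_mul]
    simp only [List.nil_append, derivWord, zero_add]
  | cons a L ih =>
    obtain ⟨y, b⟩ := a
    cases b
    · have h : FreeGroup.mk ((y, false) :: L) = (FreeGroup.of y)⁻¹ * FreeGroup.mk L := rfl
      simp only [List.cons_append, derivWord, ih, h, map_mul]
      noncomm_ring
    · have h : FreeGroup.mk ((y, true) :: L) = FreeGroup.of y * FreeGroup.mk L := rfl
      simp only [List.cons_append, derivWord, ih, h, map_mul]
      noncomm_ring

theorem derivWord_step (x : α) {L₁ L₂ : List (α × Bool)} (h : FreeGroup.Red.Step L₁ L₂) :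
    derivWord x L₁ = derivWord x L₂ := by
  obtain @⟨A, B, y, b⟩ := h
  rw [derivWord_append, derivWord_append]
  congr 2
  cases b
  · simp only [Bool.not_false, derivWord, mul_add, ← mul_assoc, ← map_mul, inv_mul_cancel,
      map_one, one_mul]
    split_ifs <;> simp
  · simp only [Bool.not_true, derivWord, mul_add, ← mul_assoc, ← map_mul, mul_inv_cancel,
      map_one, one_mul]
    split_ifs <;> simp [← MonoidAlgebra.one_def]

/-- The Fox derivative `∂w/∂x` in the integral group ring of the free group. -/
noncomputable def deriv (x : α) (w : FreeGroup α) : MonoidAlgebra ℤ (FreeGroup α) :=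
  Quot.lift (derivWord x) (fun _ _ h => derivWord_step x h) w

theorem deriv_one (x : α) : deriv x 1 = 0 := rfl

theorem deriv_of (x y : α) : deriv x (FreeGroup.of y) = if y = x then 1 else 0 := by
  change derivWord x [(y, true)] = _
  simp [derivWord]

theorem deriv_mul (x : α) (v w : FreeGroup α) :
    deriv x (v * w) = deriv x v + MonoidAlgebra.of ℤ _ v * deriv x w := by
  induction v using Quot.inductionOn with
  | _ L₁ =>
    induction w using Quot.inductionOn with
    | _ L₂ => exact derivWord_append x L₁ L₂

/-- The group presented by generators `α` and relators `r i`. -/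
abbrev Presented {ι : Type*} (r : ι → FreeGroup α) : Type _ := PresentedGroup (Set.range r)

/-- The Alexander matrix of the presentation `⟨α | r⟩`: the matrix of Fox derivatives `∂rᵢ/∂x`,
with entries pushed to the integral group ring of the abelianization of the presented group. -/
noncomputable def alexanderMatrix {ι : Type*} (r : ι → FreeGroup α) :
    Matrix ι α (MonoidAlgebra ℤ (Abelianization (Presented r))) :=
  Matrix.of fun i x =>
    MonoidAlgebra.mapDomainRingHom ℤ
      ((Abelianization.of (G := Presented r)).comp (PresentedGroup.mk (Set.range r)))
      (deriv x (r i))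

/-- Evaluation of an integral group ring at a character with values in `{1, -1}`. -/
noncomputable def evalAt {H : Type*} [CommGroup H] (χ : H →* ℤˣ) : MonoidAlgebra ℤ H →+* ℤ :=
  (MonoidAlgebra.lift ℤ ℤ H ((Units.coeHom ℤ).comp χ)).toRingHom

end Fox

/-! ### Braid groups and the Artin representation -/

namespace Braid

/-- The braid relations on the generators `σ₁, …, σₙ₋₁`; the index `i : Fin (n - 1)` stands
for `σᵢ₊₁`. -/
inductive Rel (n : ℕ) : FreeGroup (Fin (n - 1)) → Prop
  | braid (i j : Fin (n - 1)) (h : i.val + 1 = j.val) :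
      Rel n (FreeGroup.of i * FreeGroup.of j * FreeGroup.of i *
        (FreeGroup.of j * FreeGroup.of i * FreeGroup.of j)⁻¹)
  | comm (i j : Fin (n - 1)) (h : i.val + 2 ≤ j.val) :
      Rel n (FreeGroup.of i * FreeGroup.of j * (FreeGroup.of j * FreeGroup.of i)⁻¹)

/-- The braid group on `n` strands. -/
abbrev Group (n : ℕ) : Type := PresentedGroup {w | Rel n w}

/-- The standard generator `σₖ` for `1 ≤ k ≤ n - 1` (and `1` outside this range, never used). -/
def σ (n k : ℕ) : Group n :=
  if h : 1 ≤ k ∧ k < n then PresentedGroup.of ⟨k - 1, by omega⟩ else 1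

/-- The Artin automorphism of `σᵢ₊₁`:
`yᵢ₊₁ ↦ yᵢ₊₁ yᵢ₊₂ yᵢ₊₁⁻¹`, `yᵢ₊₂ ↦ yᵢ₊₁`, other generators fixed
(the index `j : Fin n` stands for the generator `yⱼ₊₁`). -/
def artinHom (n : ℕ) (i : Fin (n - 1)) : FreeGroup (Fin n) →* FreeGroup (Fin n) :=
  FreeGroup.lift fun j =>
    if j.val = i.val then
      FreeGroup.of j * FreeGroup.of ⟨i.val + 1, by omega⟩ * (FreeGroup.of j)⁻¹
    else if j.val = i.val + 1 then FreeGroup.of ⟨i.val, by omega⟩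
    else FreeGroup.of j

/-- The inverse of `artinHom`. -/
def artinInvHom (n : ℕ) (i : Fin (n - 1)) : FreeGroup (Fin n) →* FreeGroup (Fin n) :=
  FreeGroup.lift fun j =>
    if j.val = i.val then FreeGroup.of ⟨i.val + 1, by omega⟩
    else if j.val = i.val + 1 then
      (FreeGroup.of j)⁻¹ * FreeGroup.of ⟨i.val, by omega⟩ * FreeGroup.of j
    else FreeGroup.of j

theorem artinHom_of (n : ℕ) (i : Fin (n - 1)) (j : Fin n) :
    artinHom n i (FreeGroup.of j) =
      if j.val = i.val then
        FreeGroup.of j * FreeGroup.of ⟨i.val + 1, by omega⟩ * (FreeGroup.of j)⁻¹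
      else if j.val = i.val + 1 then FreeGroup.of ⟨i.val, by omega⟩
      else FreeGroup.of j := by
  simp [artinHom]

theorem artinInvHom_of (n : ℕ) (i : Fin (n - 1)) (j : Fin n) :
    artinInvHom n i (FreeGroup.of j) =
      if j.val = i.val then FreeGroup.of ⟨i.val + 1, by omega⟩
      else if j.val = i.val + 1 then
        (FreeGroup.of j)⁻¹ * FreeGroup.of ⟨i.val, by omega⟩ * FreeGroup.of j
      else FreeGroup.of j := by
  simp [artinInvHom]

/-- The Artin automorphism of a standard generator. -/
def artinAut (n : ℕ) (i : Fin (n - 1)) : MulAut (FreeGroup (Fin n)) :=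
  MonoidHom.toMulEquiv (artinHom n i) (artinInvHom n i)
    (by
      ext j
      obtain ⟨j, hj⟩ := j
      obtain ⟨i, hi⟩ := i
      rcases eq_or_ne j i with rfl | h1
      · simp [artinHom_of, artinInvHom_of]
        group
      · rcases eq_or_ne j (i + 1) with rfl | h2
        · simp [artinHom_of, artinInvHom_of]
        · simp [artinHom_of, artinInvHom_of, h1, h2])
    (by
      ext j
      obtain ⟨j, hj⟩ := j
      obtain ⟨i, hi⟩ := i
      rcases eq_or_ne j i with rfl | h1
      · simp [artinHom_of, artinInvHom_of]
      · rcases eq_or_ne j (i + 1) with rfl | h2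
        · simp [artinHom_of, artinInvHom_of]
          group
        · simp [artinHom_of, artinInvHom_of, h1, h2])

theorem artinAut_of (n : ℕ) (i : Fin (n - 1)) (j : Fin n) :
    artinAut n i (FreeGroup.of j) =
      if j.val = i.val then
        FreeGroup.of j * FreeGroup.of ⟨i.val + 1, by omega⟩ * (FreeGroup.of j)⁻¹
      else if j.val = i.val + 1 then FreeGroup.of ⟨i.val, by omega⟩
      else FreeGroup.of j := artinHom_of n i j

theorem mulAut_freeGroup_ext {α : Type*} {f g : MulAut (FreeGroup α)}
    (h : ∀ j, f (FreeGroup.of j) = g (FreeGroup.of j)) : f = g := by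
  have : f.toMonoidHom = g.toMonoidHom := FreeGroup.ext_hom _ _ h
  exact MulEquiv.ext fun x => DFunLike.congr_fun this x

theorem artin_comm (n : ℕ) (i j : Fin (n - 1)) (h : i.val + 2 ≤ j.val) :
    artinAut n i * artinAut n j = artinAut n j * artinAut n i := by
  apply mulAut_freeGroup_ext
  intro k
  obtain ⟨k, hk⟩ := k
  obtain ⟨i, hi⟩ := i
  obtain ⟨j, hj⟩ := j
  simp only at h
  simp only [MulAut.mul_apply, artinAut_of]
  split_ifs <;> first | omega | (simp only [map_mul, map_inv, artinAut_of]; split_ifs <;> first | omega | rfl)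

theorem artin_braid (n : ℕ) (i j : Fin (n - 1)) (h : i.val + 1 = j.val) :
    artinAut n i * artinAut n j * artinAut n i =
      artinAut n j * artinAut n i * artinAut n j := by
  apply mulAut_freeGroup_ext
  intro k
  obtain ⟨k, hk⟩ := k
  obtain ⟨i, hi⟩ := i
  obtain ⟨j, hj⟩ := j
  simp only at h
  subst h
  have a1 : artinAut n ⟨i, hi⟩ (FreeGroup.of ⟨i, by omega⟩) = FreeGroup.of ⟨i, by omega⟩ *
      FreeGroup.of ⟨i + 1, by omega⟩ * (FreeGroup.of ⟨i, by omega⟩)⁻¹ := by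
    rw [artinAut_of, if_pos rfl]
  have a2 : artinAut n ⟨i, hi⟩ (FreeGroup.of ⟨i + 1, by omega⟩) =
      FreeGroup.of ⟨i, by omega⟩ := by
    rw [artinAut_of, if_neg (by simp), if_pos rfl]
  have a3 : artinAut n ⟨i, hi⟩ (FreeGroup.of ⟨i + 1 + 1, by omega⟩) =
      FreeGroup.of ⟨i + 1 + 1, by omega⟩ := by
    rw [artinAut_of, if_neg (by simp only; omega), if_neg (by simp)]
  have b1 : artinAut n ⟨i + 1, hj⟩ (FreeGroup.of ⟨i + 1, by omega⟩) =
      FreeGroup.of ⟨i + 1, by omega⟩ *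
      FreeGroup.of ⟨i + 1 + 1, by omega⟩ * (FreeGroup.of ⟨i + 1, by omega⟩)⁻¹ := by
    rw [artinAut_of, if_pos rfl]
  have b2 : artinAut n ⟨i + 1, hj⟩ (FreeGroup.of ⟨i + 1 + 1, by omega⟩) =
      FreeGroup.of ⟨i + 1, by omega⟩ := by
    rw [artinAut_of, if_neg (by simp), if_pos rfl]
  have b3 : artinAut n ⟨i + 1, hj⟩ (FreeGroup.of ⟨i, by omega⟩) =
      FreeGroup.of ⟨i, by omega⟩ := by
    rw [artinAut_of, if_neg (by simp), if_neg (by simp only; omega)]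
  simp only [MulAut.mul_apply]
  by_cases h1 : k = i
  · subst h1
    simp only [a1, a2, a3, b1, b3, map_mul, map_inv]
    group
  by_cases h2 : k = i + 1
  · subst h2
    simp only [a1, a2, a3, b1, b2, b3, map_mul, map_inv]
  by_cases h3 : k = i + 1 + 1
  · subst h3
    simp only [a2, a3, b2, b3]
  have c : artinAut n ⟨i, hi⟩ (FreeGroup.of ⟨k, hk⟩) = FreeGroup.of ⟨k, hk⟩ := by
    rw [artinAut_of, if_neg h1, if_neg h2]
  have d : artinAut n ⟨i + 1, hj⟩ (FreeGroup.of ⟨k, hk⟩) = FreeGroup.of ⟨k, hk⟩ := by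
    rw [artinAut_of, if_neg h2, if_neg h3]
  simp only [c, d]

/-- The Artin representation. Braids act on the free group from the right: the product `β β'`
acts as `β` followed by `β'`. -/
def artin (n : ℕ) : Group n →* (MulAut (FreeGroup (Fin n)))ᵐᵒᵖ :=
  PresentedGroup.toGroup (f := fun i => MulOpposite.op (artinAut n i)) (by
    intro r hr
    cases hr with
    | braid i j h =>
      simp only [map_mul, map_inv, FreeGroup.lift_apply_of, ← MulOpposite.op_mul]
      rw [mul_inv_eq_one, MulOpposite.op_inj, ← mul_assoc, ← mul_assoc]
      exact artin_braid n i j h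
    | comm i j h =>
      simp only [map_mul, map_inv, FreeGroup.lift_apply_of, ← MulOpposite.op_mul]
      rw [mul_inv_eq_one, MulOpposite.op_inj]
      exact (artin_comm n i j h).symm)

/-- The automorphism of the free group given by the right action of a braid. -/
def act {n : ℕ} (β : Group n) : MulAut (FreeGroup (Fin n)) := (artin n β).unop

/-- Braids preserve every character of the free group that is constant on the generators. -/
theorem lift_const_act {n : ℕ} (t : ℤˣ) (β : Group n) (w : FreeGroup (Fin n)) :
    FreeGroup.lift (fun _ => t) (act β w) = FreeGroup.lift (fun _ => t) w := by
  have key : ∀ i : Fin (n - 1), ∀ w : FreeGroup (Fin n),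
      FreeGroup.lift (fun _ => t) (artinAut n i w) = FreeGroup.lift (fun _ => t) w := by
    intro i w
    have : (FreeGroup.lift (fun _ : Fin n => t)).comp (artinAut n i).toMonoidHom
        = FreeGroup.lift (fun _ => t) := by
      ext j
      change (((FreeGroup.lift fun _ => t) (artinAut n i (FreeGroup.of j)) : ℤˣ) : ℤ) = _
      rw [artinAut_of]
      split_ifs <;> simp
    exact DFunLike.congr_fun this w
  induction β using PresentedGroup.induction_on with
  | _ z =>
    revert w
    induction z using FreeGroup.induction_on with
    | C1 => intro w; simp [act]
    | of i => intro w; exact key i w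
    | inv_of i ih =>
      intro w
      have h := ih ((act (PresentedGroup.mk _ (FreeGroup.of i)))⁻¹ w)
      rw [MulAut.apply_inv_self] at h
      rw [h]
      simp [act]
    | mul a b iha ihb =>
      intro w
      have h : act (PresentedGroup.mk {w | Rel n w} (a * b)) w =
          act (PresentedGroup.mk {w | Rel n w} b) (act (PresentedGroup.mk {w | Rel n w} a) w) := by
        simp [act]
      rw [h, ihb, iha]

end Braid

/-! ### The deleted monomial arrangements -/

namespace DeletedMonomial

open Braid

/-- The braid `ρ₀ = σₚ₋₁ σₚ₋₂ ⋯ σ₁` on `2p` strands. -/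
def rho₀ (p : ℕ) : Braid.Group (2 * p) :=
  ((List.range (p - 1)).map fun k => σ (2 * p) (p - 1 - k)).prod

/-- The braid `τ = (σ₂ σ₄ ⋯ σ₂ₚ₋₂)(σ₃ σ₅ ⋯ σ₂ₚ₋₃) ⋯ (σₚ₋₁ σₚ₊₁)(σₚ)`; its `k`-th factor
(`k = 0, …, p - 2`) is the product of the `p - 1 - k` generators `σₖ₊₂, σₖ₊₄, …`. -/
def tau (p : ℕ) : Braid.Group (2 * p) :=
  ((List.range (p - 1)).map fun k =>
    ((List.range (p - 1 - k)).map fun j => σ (2 * p) (k + 2 + 2 * j)).prod).prod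

/-- The braid `ρ₁ = τ⁻¹ σ₁ σ₃ ⋯ σ₂ₚ₋₁ τ`. -/
def rho₁ (p : ℕ) : Braid.Group (2 * p) :=
  (tau p)⁻¹ * ((List.range p).map fun j => σ (2 * p) (2 * j + 1)).prod * tau p

/-- The braid monodromy on the generators of the free group of rank `p + 1`: the index `0` stands
for `γ₁`, which goes to `Z₁ = ρ₀ᵖ`, and the index `r` with `1 ≤ r ≤ p` for `γ₁₂:ᵣ`, which goes to
`ρ₀^(r-p) ρ₁² ρ₀^(p-r)`. -/
def monodromy (p : ℕ) (g : Fin (p + 1)) : Braid.Group (2 * p) :=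
  if g = 0 then rho₀ p ^ p
  else rho₀ p ^ ((g.val : ℤ) - p) * rho₁ p ^ 2 * rho₀ p ^ ((p : ℤ) - g.val)

/-- The braid monodromy followed by the conjugation `β ↦ τ β τ⁻¹`. -/
def monodromyConj (p : ℕ) (g : Fin (p + 1)) : Braid.Group (2 * p) :=
  tau p * monodromy p g * (tau p)⁻¹

/-- Names for the generators `u₁, …, uₚ` (`Sum.inl`) and `v₁, …, vₚ` (`Sum.inr`); the index
`r : Fin p` stands for `uᵣ₊₁` or `vᵣ₊₁`. -/
abbrev UV (p : ℕ) : Type := Fin p ⊕ Fin p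

/-- The generator `yₖ` for `1 ≤ k ≤ 2p` (and `1` outside this range, never used). -/
def y (p k : ℕ) : FreeGroup (Fin (2 * p)) :=
  if h : 1 ≤ k ∧ k ≤ 2 * p then FreeGroup.of ⟨k - 1, by omega⟩ else 1

/-- `uᵣ ↦ y₁ y₂ ⋯ y₂ᵣ` and `vᵣ ↦ y₂ᵣ₋₁`. -/
def uvToY (p : ℕ) : FreeGroup (UV p) →* FreeGroup (Fin (2 * p)) :=
  FreeGroup.lift (Sum.elim
    (fun r => ((List.range (2 * (r.val + 1))).map fun k => y p (k + 1)).prod)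
    (fun r => y p (2 * r.val + 1)))

/-- `uₖ` for `1 ≤ k ≤ p`, and `u₀ = 1`. -/
def u (p k : ℕ) : FreeGroup (UV p) :=
  if h : 1 ≤ k ∧ k ≤ p then FreeGroup.of (Sum.inl ⟨k - 1, by omega⟩) else 1

/-- `y₂ᵣ₋₁ ↦ vᵣ` and `y₂ᵣ ↦ vᵣ⁻¹ uᵣ₋₁⁻¹ uᵣ`. -/
def yToUV (p : ℕ) : FreeGroup (Fin (2 * p)) →* FreeGroup (UV p) :=
  FreeGroup.lift fun j =>
    if j.val % 2 = 0 then FreeGroup.of (Sum.inr ⟨j.val / 2, by omega⟩)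
    else (FreeGroup.of (Sum.inr ⟨j.val / 2, by omega⟩))⁻¹ *
      (u p (j.val / 2))⁻¹ * u p (j.val / 2 + 1)

theorem yToUV_odd (p k : ℕ) (hk : k < p) :
    yToUV p (y p (2 * k + 1)) = FreeGroup.of (Sum.inr ⟨k, hk⟩) := by
  rw [y, dif_pos (by omega)]
  simp [yToUV]

theorem yToUV_even (p k : ℕ) (hk : k < p) :
    yToUV p (y p (2 * k + 1 + 1)) =
      (FreeGroup.of (Sum.inr ⟨k, hk⟩))⁻¹ * (u p k)⁻¹ * u p (k + 1) := by
  rw [y, dif_pos (by omega)]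
  have h2 : (2 * k + 1) / 2 = k := by omega
  simp [yToUV, h2]

theorem yToUV_prefix (p k : ℕ) (hk : k ≤ p) :
    yToUV p ((List.range (2 * k)).map fun i => y p (i + 1)).prod = u p k := by
  induction k with
  | zero => simp [u]
  | succ k ih =>
    have e : 2 * (k + 1) = 2 * k + 1 + 1 := by ring
    rw [e, List.range_succ, List.range_succ]
    simp only [List.map_append, List.prod_append, List.map_cons, List.map_nil, List.prod_cons,
      List.prod_nil, mul_one, map_mul]
    rw [ih (by omega), yToUV_odd p k hk, yToUV_even p k hk]
    group

theorem uvToY_u (p k : ℕ) (hk : k ≤ p) :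
    uvToY p (u p k) = ((List.range (2 * k)).map fun i => y p (i + 1)).prod := by
  rcases k with _ | k
  · simp [u]
  · rw [u, dif_pos (by omega)]
    simp [uvToY]

/-- `{u₁, …, uₚ, v₁, …, vₚ}` is a free basis of the free group on `y₁, …, y₂ₚ`. -/
def basisEquiv (p : ℕ) : FreeGroup (UV p) ≃* FreeGroup (Fin (2 * p)) :=
  MonoidHom.toMulEquiv (uvToY p) (yToUV p)
    (by
      apply FreeGroup.ext_hom
      rintro (⟨r, hr⟩ | ⟨r, hr⟩)
      · simp only [MonoidHom.comp_apply, MonoidHom.id_apply, uvToY, FreeGroup.lift_apply_of,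
          Sum.elim_inl]
        rw [yToUV_prefix p (r + 1) hr, u, dif_pos (by omega)]
        simp
      · simp only [MonoidHom.comp_apply, MonoidHom.id_apply, uvToY, FreeGroup.lift_apply_of,
          Sum.elim_inr]
        exact yToUV_odd p r hr)
    (by
      apply FreeGroup.ext_hom
      rintro ⟨j, hj⟩
      have hy : FreeGroup.of (⟨j, hj⟩ : Fin (2 * p)) = y p (j + 1) := by
        rw [y, dif_pos (by omega)]
        simp
      rw [hy, MonoidHom.comp_apply, MonoidHom.id_apply]
      rcases Nat.even_or_odd' j with ⟨k, rfl | rfl⟩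
      · rw [yToUV_odd p k (by omega)]
        simp [uvToY]
      · rw [yToUV_even p k (by omega)]
        simp only [map_mul, map_inv]
        rw [uvToY_u p k (by omega), uvToY_u p (k + 1) (by omega)]
        have e : 2 * (k + 1) = 2 * k + 1 + 1 := by ring
        rw [e, List.range_succ, List.range_succ]
        simp [uvToY])

/-- The generators of the presentation: `γ₁, γ₁₂:₁, …, γ₁₂:ₚ`, then the `uᵣ`, then the `vᵣ`. -/
abbrev Gen (p : ℕ) : Type := Fin (p + 1) ⊕ UV p

/-- The inclusion of the free group on `u₁, …, uₚ, v₁, …, vₚ`. -/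
def inclUV (p : ℕ) : FreeGroup (UV p) →* FreeGroup (Gen p) := FreeGroup.map Sum.inr

/-- The action of the braid `τ η(γ) τ⁻¹` in terms of the generators `uᵣ`, `vᵣ`. -/
def uvAct (p : ℕ) (g : Fin (p + 1)) (w : FreeGroup (UV p)) : FreeGroup (UV p) :=
  (basisEquiv p).symm (act (monodromyConj p g) (basisEquiv p w))

/-- The relators of the presentation: `x γ = γ · γ(x)`, for `γ` among `γ₁, γ₁₂:₁, …, γ₁₂:ₚ` and
`x` among the `uᵣ` and `vᵣ`. -/
def relator (p : ℕ) (i : Fin (p + 1) × UV p) : FreeGroup (Gen p) :=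
  FreeGroup.of (Sum.inr i.2) * FreeGroup.of (Sum.inl i.1) *
    (FreeGroup.of (Sum.inl i.1) * inclUV p (uvAct p i.1 (FreeGroup.of i.2)))⁻¹

/-- The group of the decone, given by the above presentation. -/
abbrev G (p : ℕ) : Type := Fox.Presented (relator p)

/-- The values on the generators of the character with `γ₁ ↦ t`, `γ₁₂:ᵣ ↦ t²`, `yᵢ ↦ t`. -/
def charGen (p : ℕ) (t : ℤˣ) : Gen p → ℤˣ :=
  Sum.elim (fun g => if g = 0 then t else t ^ 2)
    (fun x => FreeGroup.lift (fun _ => t) (basisEquiv p (FreeGroup.of x)))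

theorem charGen_inclUV (p : ℕ) (t : ℤˣ) (w : FreeGroup (UV p)) :
    FreeGroup.lift (charGen p t) (inclUV p w) = FreeGroup.lift (fun _ => t) (basisEquiv p w) := by
  have : (FreeGroup.lift (charGen p t)).comp (inclUV p) =
      (FreeGroup.lift (fun _ => t)).comp (basisEquiv p).toMonoidHom := by
    ext x
    simp [inclUV, charGen]
  exact DFunLike.congr_fun this w

/-- The character `γ₁ ↦ t`, `γ₁₂:ᵣ ↦ t²`, `yᵢ ↦ t` of the group of the decone. -/
def character (p : ℕ) (t : ℤˣ) : G p →* ℤˣ :=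
  PresentedGroup.toGroup (f := charGen p t) (by
    rintro _ ⟨⟨g, x⟩, rfl⟩
    have h : FreeGroup.lift (charGen p t) (inclUV p (uvAct p g (FreeGroup.of x))) =
        charGen p t (Sum.inr x) := by
      rw [charGen_inclUV, uvAct, MulEquiv.apply_symm_apply, lift_const_act]
      rfl
    simp only [relator, map_mul, map_inv, FreeGroup.lift_apply_of, h]
    rw [mul_comm, inv_mul_eq_one, mul_comm])

/-- The integer matrix obtained by evaluating the Alexander matrix of the presentation at the
character `γ₁ ↦ -1`, `γ₁₂:ᵣ ↦ (-1)² = 1`, `yᵢ ↦ -1`. -/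
noncomputable def A₂ (p : ℕ) : Matrix (Fin (p + 1) × UV p) (Gen p) ℤ :=
  (Fox.alexanderMatrix (relator p)).map
    (Fox.evalAt (Abelianization.lift (character p (-1))))

end DeletedMonomial

/-! ### Smith normal forms from row lattices -/

/-! At `t = -1` the Artin action linearizes to the rule of Fox colourings: `σᵢ` sends `eᵢ` to `2eᵢ -
eᵢ₊₁` and `eᵢ₊₁` to `eᵢ` (`lin_σ`). A change of coordinates absorbs both the basis `uᵣ, vᵣ` and the
conjugation by `τ` (`coords_row`). The row lattice is then the sum over `γ` of the ranges of
`block`, which sends `z` to the pair of `-2 coordSum(z)` times the unit vector of `γ`, and `z - γ(t)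
η(γ)z`, where `γ(t) = -1` for `γ₁` and `1` otherwise.

These vectors are all even. The braid `ρ₀ᵖ` acts on `y₁, …, yₚ` like conjugation by their product,
and `ρ₁²` changes a suitable basis vector by twice an arc vector. So the row lattice is `2Λ`, and
`Λ` has to be identified. The answer is that `Λ` is cut out by `degree = 0` and `twist ≡ 0 mod p`.

One inclusion (`range_block_le`) rests on the dihedral colouring `e_k ↦ 2k - 1` for `k ≤ p`, `e_k ↦
0` for `k > p`: modulo `p`, `ρ₀` negates it, and it equals `-1` on every arc. For the other
(`two_smul_mem_of_mem_halfLattice`), the projection to the quotient by the halved row lattice is a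
functional satisfying all the relations. Equality on all arcs makes its values on `e₁, …, eₚ` an
arithmetic progression, equality on the arcs rotated by `ρ₀` makes the step `p`-torsion, and
`altSum` fixes the constant (`exists_dihedral_form`). The projection is therefore a combination of
`degree` and `twist`, the latter with a `p`-torsion coefficient.

Finally `degree` and `twist` form a unimodular pair, hence are two coordinates of some basis. One
direction is missing from `Λ`, one is multiplied by `p`, and the others are free, which gives `2, …,
2, 2p, 0` (`hasSmithNormalForm_of_range`). -/

/-- A basis of the target of a surjection of free `ℤ`-modules lifts to a basis of the source
whose remaining members lie in the kernel. -/
theorem exists_basis_lift {M N : Type*} [AddCommGroup M] [AddCommGroup N] [Module.Free ℤ M]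
    [Module.Finite ℤ M] (f : M →ₗ[ℤ] N) (hf : Function.Surjective f) {r m : ℕ}
    (b : Module.Basis (Fin r) ℤ N) (hm : Module.finrank ℤ M = m) :
    ∃ β : Module.Basis (Fin m) ℤ M,
      ∀ i : Fin m, f (β i) = if h : i.val < r then b ⟨i.val, h⟩ else 0 := by
  have : Module.Free ℤ N := Module.Free.of_basis b
  obtain ⟨s, hs⟩ := Module.projective_lifting_property f LinearMap.id hf
  have hs' : ∀ x, f (s x) = x := fun x => LinearMap.congr_fun hs x
  let e : M ≃ₗ[ℤ] N × LinearMap.ker f :=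
    LinearEquiv.ofLinearMap
      (f.prod (LinearMap.codRestrict (LinearMap.ker f) (LinearMap.id - s ∘ₗ f)
        (by intro x; simp [hs'])))
      (s.coprod (LinearMap.ker f).subtype)
      (by
        ext x
        · simp [hs']
        · simp [hs']
        · simp
        · simp)
      (by ext x; simp)
  have hr : Module.finrank ℤ N = r := by simp [Module.finrank_eq_card_basis b]
  have : Module.Finite ℤ N := Module.Finite.of_basis b
  have hk := e.finrank_eq
  rw [Module.finrank_prod, hr, hm] at hk
  let B := ((b.prod (Module.finBasis ℤ (LinearMap.ker f))).map e.symm).reindex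
    (finSumFinEquiv.trans (finCongr hk.symm))
  refine ⟨B, fun i => ?_⟩
  obtain ⟨i, rfl⟩ := (finSumFinEquiv.trans (finCongr hk.symm)).surjective i
  rcases i with i | i
  · simp [B, e, hs']
  · simp [B, e]

theorem rectDiagonal_mul {M N : ℕ} (d : List ℤ) (W : Matrix (Fin N) (Fin N) ℤ) (i : Fin M)
    (j : Fin N) :
    (rectDiagonal M N d * W) i j = if h : i.val < N then d.getD i.val 0 * W ⟨i.val, h⟩ j else 0 := by
  rw [Matrix.mul_apply]
  split_ifs with h
  · rw [Finset.sum_eq_single ⟨i.val, h⟩]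
    · simp [rectDiagonal]
    · intro k _ hk
      have : i.val ≠ k.val := fun h' => hk (Fin.ext h'.symm)
      simp [rectDiagonal, this]
    · simp
  · refine Finset.sum_eq_zero fun k _ => ?_
    have : i.val ≠ k.val := by omega
    simp [rectDiagonal, this]

section

open scoped Matrix

/-- If the row lattice of `A` has the basis `d₀ b₀, d₁ b₁, …` for some basis `b` of the ambient
lattice, then `A` is equivalent to the rectangular diagonal matrix of `d`. -/
theorem exists_diagonalization {m n : Type*} [Fintype m] [Fintype n] [DecidableEq m]
    [DecidableEq n]
    (A : Matrix m n ℤ) (d : List ℤ) (hd : ∀ x ∈ d, 0 < x)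
    (hn : d.length ≤ Fintype.card n)
    (b : Module.Basis (Fin (Fintype.card n)) ℤ (n → ℤ))
    (hA : LinearMap.range A.vecMulLinear =
      Submodule.span ℤ (Set.range fun i : Fin d.length => d.get i • b (Fin.castLE hn i)))
    (er : m ≃ Fin (Fintype.card m)) (ec : n ≃ Fin (Fintype.card n)) :
    ∃ (U : Matrix (Fin (Fintype.card m)) (Fin (Fintype.card m)) ℤ)
      (V : Matrix (Fin (Fintype.card n)) (Fin (Fintype.card n)) ℤ),
      IsUnit U ∧ IsUnit V ∧
        U * Matrix.reindex er ec A * V = rectDiagonal (Fintype.card m) (Fintype.card n) d := by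
  have hli : LinearIndependent ℤ fun i : Fin d.length => d.get i • b (Fin.castLE hn i) := by
    have h1 : LinearIndependent ℤ fun i : Fin d.length => b (Fin.castLE hn i) :=
      b.linearIndependent.comp _ (Fin.castLE_injective hn)
    rw [Fintype.linearIndependent_iff] at h1 ⊢
    intro g hg i
    have h2 := h1 (fun i => g i * d.get i) (by simpa [mul_smul] using hg) i
    exact (mul_eq_zero.1 h2).resolve_right (hd _ (List.get_mem _ _)).ne'
  let bS := Module.Basis.span hli
  let f : (m → ℤ) →ₗ[ℤ] Submodule.span ℤ
      (Set.range fun i : Fin d.length => d.get i • b (Fin.castLE hn i)) :=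
    LinearMap.codRestrict _ A.vecMulLinear fun x => hA ▸ LinearMap.mem_range_self _ x
  have hf : Function.Surjective f := by
    rintro ⟨y, hy⟩
    rw [← hA] at hy
    obtain ⟨x, rfl⟩ := hy
    exact ⟨x, rfl⟩
  -- The lifted basis supplies the rows of `U`: its first members combine the rows of `A` into the
  -- given lattice basis, and the remaining ones are relations between the rows.
  obtain ⟨β, hβ⟩ := exists_basis_lift f hf bS (m := Fintype.card m) (by simp)
  have hβ' : ∀ i, Matrix.vecMul (β i) A =
      if h : i.val < d.length then d.get ⟨i, h⟩ • b ⟨i.val, by omega⟩ else 0 := by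
    intro i
    have h1 : Matrix.vecMul (β i) A = (f (β i) : n → ℤ) := rfl
    rw [h1, hβ]
    split_ifs with h
    · simp [bS, Module.Basis.span_apply, Fin.castLE]
    · rfl
  let Em := (Pi.basisFun ℤ m).reindex er
  let En := (Pi.basisFun ℤ n).reindex ec
  have hU : IsUnit (Em.toMatrix β)ᵀ := by
    rw [Matrix.isUnit_transpose]
    exact ⟨⟨_, _, Em.toMatrix_mul_toMatrix_flip β, β.toMatrix_mul_toMatrix_flip Em⟩, rfl⟩
  have hV : IsUnit (b.toMatrix En)ᵀ := by
    rw [Matrix.isUnit_transpose]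
    exact ⟨⟨_, _, b.toMatrix_mul_toMatrix_flip En, En.toMatrix_mul_toMatrix_flip b⟩, rfl⟩
  refine ⟨_, _, hU, hV, ?_⟩
  have key : (Em.toMatrix β)ᵀ * Matrix.reindex er ec A =
      rectDiagonal (Fintype.card m) (Fintype.card n) d * (En.toMatrix b)ᵀ := by
    ext i j
    have h1 : ((Em.toMatrix β)ᵀ * Matrix.reindex er ec A) i j =
        Matrix.vecMul (β i) A (ec.symm j) := by
      simp only [Matrix.mul_apply, Matrix.vecMul, dotProduct]
      rw [← er.symm.sum_comp]
      simp [Em, Module.Basis.toMatrix_apply]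
    rw [h1, hβ', rectDiagonal_mul]
    by_cases h : i.val < d.length
    · have h' : i.val < Fintype.card n := by omega
      rw [dif_pos h, dif_pos h', List.getD_eq_getElem _ _ h]
      simp [En, Module.Basis.toMatrix_apply]
    · rw [dif_neg h, List.getD_eq_default _ _ (by omega)]
      simp
  rw [key, Matrix.mul_assoc, ← Matrix.transpose_mul, b.toMatrix_mul_toMatrix_flip,
    Matrix.transpose_one, Matrix.mul_one]

end

/-- A matrix whose row lattice consists of the vectors `2x` with `χ x = 0` and `q ∣ ψ x`, for a
unimodular pair of functionals `χ`, `ψ`, has Smith normal form `2, …, 2, 2q, 0`. -/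
theorem hasSmithNormalForm_of_range {m n : Type*} [Fintype m] [Fintype n] [DecidableEq m]
    [DecidableEq n]
    (A : Matrix m n ℤ) (q k : ℕ) (hq : 0 < q) (hm : k + 1 ≤ Fintype.card m)
    (hn : Fintype.card n = k + 2) (χ ψ : (n → ℤ) →ₗ[ℤ] ℤ) (a b : n → ℤ)
    (hχa : χ a = 1) (hψb : ψ b = 1) (hχb : χ b = 0)
    (hA : ∀ y, y ∈ LinearMap.range A.vecMulLinear ↔
      ∃ x, y = (2 : ℤ) • x ∧ χ x = 0 ∧ (q : ℤ) ∣ ψ x) :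
    HasSmithNormalForm A (List.replicate k 2 ++ [2 * (q : ℤ)]) := by
  have hpos : ∀ x ∈ List.replicate k 2 ++ [2 * (q : ℤ)], 0 < x := by
    intro x hx
    rw [List.mem_append, List.mem_singleton] at hx
    rcases hx with hx | rfl
    · rw [List.eq_of_mem_replicate hx]; norm_num
    · positivity
  have hlen : (List.replicate k 2 ++ [2 * (q : ℤ)]).length = k + 1 := by simp
  have hle : (List.replicate k 2 ++ [2 * (q : ℤ)]).length ≤ Fintype.card n := by omega
  refine ⟨hpos, ?_, by omega, by omega, fun er ec => ?_⟩
  · rw [List.pairwise_append]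
    refine ⟨by simp [List.pairwise_replicate], by simp, ?_⟩
    intro x hx y hy
    rw [List.eq_of_mem_replicate hx, List.mem_singleton.1 hy]
    exact dvd_mul_right _ _
  let F : (n → ℤ) →ₗ[ℤ] (Fin 2 → ℤ) := LinearMap.pi ![χ, ψ]
  have hF : Function.Surjective F := by
    intro z
    -- The value `ψ a` is arbitrary, so `a` is corrected by a multiple of `b` to obtain a pair dual
    -- to `χ`, `ψ`.
    refine ⟨z 0 • (a - ψ a • b) + z 1 • b, ?_⟩
    ext i
    fin_cases i
    · change χ _ = z 0
      simp only [map_add, map_smul, map_sub, smul_eq_mul, hχa, hχb]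
      ring
    · change ψ _ = z 1
      simp only [map_add, map_smul, map_sub, smul_eq_mul, hψb]
      ring
  obtain ⟨β, hβ⟩ := exists_basis_lift F hF (Pi.basisFun ℤ (Fin 2)) (m := k + 2) (by simp [hn])
  have hβχ : ∀ i : Fin (k + 2), χ (β i) = if i.val = 0 then 1 else 0 := by
    intro i
    have h := congrFun (hβ i) 0
    have h0 : F (β i) 0 = χ (β i) := rfl
    rw [h0] at h
    rw [h]
    split_ifs with h1 h2 h3
    · simp [h2]
    · simp [Fin.ext_iff, Ne.symm h2]
    · omega
    · rfl
  have hβψ : ∀ i : Fin (k + 2), ψ (β i) = if i.val = 1 then 1 else 0 := by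
    intro i
    have h := congrFun (hβ i) 1
    have h0 : F (β i) 1 = ψ (β i) := rfl
    rw [h0] at h
    rw [h]
    split_ifs with h1 h2 h3
    · simp [h2]
    · simp [Fin.ext_iff, Ne.symm h2]
    · omega
    · rfl
  -- Reversal puts `β 0`, the direction absent from the lattice, last and `β 1`, the direction with
  -- factor `2q`, just before it.
  let b' := β.reindex (Fin.revPerm.trans (finCongr hn.symm))
  have hb' : ∀ i : Fin (Fintype.card n), b' i = β (Fin.rev (Fin.cast hn i)) := by
    intro i
    simp [b']
  refine exists_diagonalization A _ hpos hle b' ?_ er ec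
  have hget : ∀ i : Fin (List.replicate k 2 ++ [2 * (q : ℤ)]).length,
      (List.replicate k 2 ++ [2 * (q : ℤ)]).get i = if i.val < k then 2 else 2 * (q : ℤ) := by
    intro i
    rw [List.get_eq_getElem, List.getElem_append]
    split_ifs with h1 h2 h3
    · simp
    · simp at h1; omega
    · simp at h1; omega
    · simp
  apply le_antisymm
  · intro y hy
    obtain ⟨x, rfl, hx1, hx2⟩ := (hA y).1 hy
    have hx : x = ∑ i, β.repr x i • β i := (β.sum_repr x).symm
    have hc0 : β.repr x ⟨0, by omega⟩ = 0 := by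
      rw [hx, map_sum] at hx1
      simp only [map_smul, hβχ] at hx1
      rw [Finset.sum_eq_single (⟨0, by omega⟩ : Fin (k + 2))] at hx1
      · simpa using hx1
      · intro i _ hi
        have : i.val ≠ 0 := fun h => hi (Fin.ext h)
        simp [this]
      · simp
    have hc1 : (q : ℤ) ∣ β.repr x ⟨1, by omega⟩ := by
      rw [hx, map_sum] at hx2
      simp only [map_smul, hβψ] at hx2
      rw [Finset.sum_eq_single (⟨1, by omega⟩ : Fin (k + 2))] at hx2
      · simpa using hx2
      · intro i _ hi
        have : i.val ≠ 1 := fun h => hi (Fin.ext h)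
        simp [this]
      · simp
    rw [hx, Finset.smul_sum]
    refine Submodule.sum_mem _ fun i _ => ?_
    by_cases hi0 : i.val = 0
    · have : i = ⟨0, by omega⟩ := Fin.ext hi0
      rw [this, hc0]; simp
    have key : ∀ j : Fin (List.replicate k 2 ++ [2 * (q : ℤ)]).length, i.val + j.val = k + 1 →
        (if j.val < k then 2 else 2 * (q : ℤ)) • β i ∈ Submodule.span ℤ
        (Set.range fun i : Fin (List.replicate k 2 ++ [2 * (q : ℤ)]).length =>
          (List.replicate k 2 ++ [2 * (q : ℤ)]).get i • b' (Fin.castLE hle i)) := by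
      intro j hj
      apply Submodule.subset_span
      refine ⟨j, ?_⟩
      simp only [hget, hb']
      congr 2
      apply Fin.ext
      simp [Fin.rev]
      omega
    by_cases hi1 : i.val = 1
    · obtain ⟨t, ht⟩ := hc1
      have : i = ⟨1, by omega⟩ := Fin.ext hi1
      have h := key ⟨k, by omega⟩ (by simp only; omega)
      rw [if_neg (by simp)] at h
      rw [this] at h ⊢
      rw [ht]
      convert Submodule.smul_mem _ t h using 1
      module
    · have h := key ⟨k + 1 - i.val, by omega⟩ (by simp only; omega)
      rw [if_pos (by simp only; omega)] at h
      convert Submodule.smul_mem _ (β.repr x i) h using 1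
      module
  · rw [Submodule.span_le]
    rintro _ ⟨i, rfl⟩
    apply (hA _).2
    simp only [hget, hb']
    have hi : i.val < k + 1 := i.2.trans_eq hlen
    split_ifs with h
    · refine ⟨_, rfl, ?_, ?_⟩
      · rw [hβχ, if_neg]
        simp only [Fin.val_rev, Fin.val_cast, Fin.val_castLE]
        omega
      · rw [hβψ, if_neg]
        · simp
        simp only [Fin.val_rev, Fin.val_cast, Fin.val_castLE]
        omega
    · refine ⟨(q : ℤ) • β (Fin.rev (Fin.cast hn (Fin.castLE hle i))), by module, ?_, ?_⟩
      · rw [map_smul, hβχ, if_neg]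
        · simp
        simp only [Fin.val_rev, Fin.val_cast, Fin.val_castLE]
        omega
      · rw [map_smul]
        exact dvd_mul_right _ _

namespace Fox

/-! ### Fox derivatives at a sign character -/

section

variable {α β : Type*} [DecidableEq α] [DecidableEq β]

/-- The vector of Fox derivatives of a word, evaluated at a character with values `±1`. -/
noncomputable def vec (χ : FreeGroup α →* ℤˣ) (w : FreeGroup α) : α → ℤ :=
  fun x => MonoidAlgebra.lift ℤ ℤ (FreeGroup α) ((Units.coeHom ℤ).comp χ) (deriv x w)

theorem vec_one (χ : FreeGroup α →* ℤˣ) : vec χ 1 = 0 := by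
  ext x
  simp [vec, deriv_one]

theorem vec_of (χ : FreeGroup α →* ℤˣ) (y : α) : vec χ (FreeGroup.of y) = Pi.single y 1 := by
  ext x
  rw [vec, deriv_of, Pi.single_apply]
  by_cases h : y = x
  · simp [h]
  · simp [h, Ne.symm h]

theorem vec_mul (χ : FreeGroup α →* ℤˣ) (v w : FreeGroup α) :
    vec χ (v * w) = vec χ v + (χ v : ℤ) • vec χ w := by
  ext x
  simp [vec, deriv_mul]

theorem vec_inv (χ : FreeGroup α →* ℤˣ) (w : FreeGroup α) :
    vec χ w⁻¹ = -((χ w : ℤ) • vec χ w) := by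
  have h := vec_mul χ w w⁻¹
  rw [mul_inv_cancel, vec_one] at h
  -- Values are signs, so multiplying by `χ w` twice does nothing; this replaces the inverse of `χ
  -- w` by `χ w` itself.
  have h2 : (χ w : ℤ) • ((χ w : ℤ) • vec χ w⁻¹) = vec χ w⁻¹ := by
    rw [smul_smul, ← Units.val_mul, Int.units_mul_self]; simp
  rw [← h2, ← smul_neg, eq_neg_of_add_eq_zero_right h.symm]

theorem vec_mul_inv (χ : FreeGroup α →* ℤˣ) (v w : FreeGroup α) (h : χ v = χ w) :
    vec χ (v * w⁻¹) = vec χ v - vec χ w := by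
  rw [vec_mul, vec_inv, h, smul_neg, smul_smul, ← Units.val_mul, Int.units_mul_self]
  simp [sub_eq_add_neg]

omit [DecidableEq α] in
/-- Crossed homomorphisms agree when they agree on generators. -/
theorem crossed_ext {N : Type*} [AddCommGroup N] (χ : FreeGroup α →* ℤˣ) (f g : FreeGroup α → N)
    (hf : ∀ v w, f (v * w) = f v + (χ v : ℤ) • f w)
    (hg : ∀ v w, g (v * w) = g v + (χ v : ℤ) • g w)
    (h : ∀ x, f (FreeGroup.of x) = g (FreeGroup.of x)) (w : FreeGroup α) : f w = g w := by
  have one : ∀ f : FreeGroup α → N, (∀ v w, f (v * w) = f v + (χ v : ℤ) • f w) → f 1 = 0 := by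
    intro f hf
    simpa using hf 1 1
  have inv : ∀ f : FreeGroup α → N, (∀ v w, f (v * w) = f v + (χ v : ℤ) • f w) →
      ∀ w, f w⁻¹ = -(((χ w⁻¹ : ℤˣ) : ℤ) • f w) := by
    intro f hf w
    have := hf w⁻¹ w
    rw [inv_mul_cancel, one f hf] at this
    exact eq_neg_of_add_eq_zero_left this.symm
  induction w using FreeGroup.induction_on with
  | C1 => rw [one f hf, one g hg]
  | of x => exact h x
  | inv_of x ih => rw [inv f hf, inv g hg, ih]
  | mul a b ha hb => rw [hf, hg, ha, hb]

variable [Fintype α]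

/-- The evaluated Fox Jacobian of a homomorphism of free groups, as a linear map. -/
noncomputable def jac (χ : FreeGroup β →* ℤˣ) (φ : FreeGroup α →* FreeGroup β) :
    (α → ℤ) →ₗ[ℤ] (β → ℤ) :=
  Fintype.linearCombination ℤ fun x => vec χ (φ (FreeGroup.of x))

/-- This is the chain rule of Fox calculus: both sides are crossed homomorphisms in `w`, so
agreement on generators suffices. -/
theorem jac_vec (χ : FreeGroup β →* ℤˣ) (φ : FreeGroup α →* FreeGroup β) (χ' : FreeGroup α →* ℤˣ)
    (h : ∀ w, χ (φ w) = χ' w) (w : FreeGroup α) : jac χ φ (vec χ' w) = vec χ (φ w) := by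
  refine crossed_ext χ' (fun w => jac χ φ (vec χ' w)) (fun w => vec χ (φ w)) ?_ ?_ ?_ w
  · intro v w
    simp only [vec_mul, map_add, map_smul]
  · intro v w
    simp only [map_mul, vec_mul, h]
  · intro x
    simp [vec_of, jac, Fintype.linearCombination_apply_single]

theorem linearMap_ext_vec {N : Type*} [AddCommGroup N] (χ : FreeGroup α →* ℤˣ)
    {f g : (α → ℤ) →ₗ[ℤ] N} (h : ∀ w, f (vec χ w) = g (vec χ w)) : f = g := by
  refine LinearMap.pi_ext' fun x => LinearMap.ext_ring ?_
  have := h (FreeGroup.of x)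
  rw [vec_of] at this
  simpa using this

variable [Fintype β]

/-- The linear equivalence induced by an isomorphism of free groups. -/
noncomputable def jacEquiv (χ : FreeGroup β →* ℤˣ) (χ' : FreeGroup α →* ℤˣ)
    (φ : FreeGroup α ≃* FreeGroup β) (h : ∀ w, χ (φ w) = χ' w) : (α → ℤ) ≃ₗ[ℤ] (β → ℤ) :=
  have h' : ∀ w, χ' (φ.symm w) = χ w := fun w => by rw [← h, MulEquiv.apply_symm_apply]
  LinearEquiv.ofLinearMap (jac χ φ.toMonoidHom) (jac χ' φ.symm.toMonoidHom)
    (by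
      refine linearMap_ext_vec χ fun w => ?_
      rw [LinearMap.comp_apply, jac_vec χ' φ.symm.toMonoidHom χ h',
        jac_vec χ φ.toMonoidHom χ' h]
      simp)
    (by
      refine linearMap_ext_vec χ' fun w => ?_
      rw [LinearMap.comp_apply, jac_vec χ φ.toMonoidHom χ' h,
        jac_vec χ' φ.symm.toMonoidHom χ h']
      simp)

theorem jacEquiv_vec (χ : FreeGroup β →* ℤˣ) (χ' : FreeGroup α →* ℤˣ)
    (φ : FreeGroup α ≃* FreeGroup β) (h : ∀ w, χ (φ w) = χ' w) (w : FreeGroup α) :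
    jacEquiv χ χ' φ h (vec χ' w) = vec χ (φ w) :=
  jac_vec χ φ.toMonoidHom χ' h w

end

end Fox

namespace DeletedMonomial

open Fox Braid

/-! ### Rows of the evaluated Alexander matrix as Fox vectors. -/

theorem A₂_apply (p : ℕ) (i : Fin (p + 1) × UV p) (x : Gen p) :
    A₂ p i x = vec (FreeGroup.lift (charGen p (-1))) (relator p i) x := by
  have h : ((evalAt (Abelianization.lift (character p (-1)))).comp
      (MonoidAlgebra.mapDomainRingHom ℤ
        ((Abelianization.of (G := Presented (relator p))).comp
          (PresentedGroup.mk (Set.range (relator p)))))) =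
      (MonoidAlgebra.lift ℤ ℤ (FreeGroup (Gen p))
        ((Units.coeHom ℤ).comp (FreeGroup.lift (charGen p (-1))))).toRingHom := by
    refine MonoidAlgebra.ringHom_ext (fun r => ?_) (fun w => ?_)
    · simp [evalAt]
    · have hw : character p (-1) (PresentedGroup.mk (Set.range (relator p)) w) =
          FreeGroup.lift (charGen p (-1)) w := rfl
      simp [evalAt, hw]
  exact RingHom.congr_fun h _

/-- The character `yᵢ ↦ -1`. -/
def sgn (p : ℕ) : FreeGroup (Fin (2 * p)) →* ℤˣ := FreeGroup.lift fun _ => -1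

/-- The character `yᵢ ↦ -1` in terms of the generators `uᵣ`, `vᵣ`. -/
def sgnUV (p : ℕ) : FreeGroup (UV p) →* ℤˣ := (sgn p).comp (basisEquiv p).toMonoidHom

theorem sgn_act (p : ℕ) (β : Braid.Group (2 * p)) (w : FreeGroup (Fin (2 * p))) :
    sgn p (act β w) = sgn p w := lift_const_act _ _ _

theorem vec_inclUV (p : ℕ) (w : FreeGroup (UV p)) :
    vec (FreeGroup.lift (charGen p (-1))) (inclUV p w) = Sum.elim (0 : Fin (p + 1) → ℤ) (vec (sgnUV p) w) := by
  refine crossed_ext (sgnUV p) (fun w => vec (FreeGroup.lift (charGen p (-1))) (inclUV p w))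
    (fun w => Sum.elim (0 : Fin (p + 1) → ℤ) (vec (sgnUV p) w)) ?_ ?_ ?_ w
  · intro v w
    simp only [map_mul, vec_mul, charGen_inclUV]
    rfl
  · intro v w
    ext (i | i) <;> simp [vec_mul]
  · intro x
    simp only [inclUV, FreeGroup.map.of, vec_of]
    ext (i | i) <;> simp [Pi.single_apply]

/-- The sign of the `g`-th braid generator: `γ₁ ↦ -1`, `γ₁₂:ᵣ ↦ 1`. -/
def genSign (p : ℕ) (g : Fin (p + 1)) : ℤ := if g = 0 then -1 else 1

/-- Braids preserve the character, so both sides of a relation have the same sign and the Fox vector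
of the relator is the difference of their Fox vectors. The two contributions at `γ` are `χ(x)` and
`-1`. -/
theorem A₂_row (p : ℕ) (g : Fin (p + 1)) (x : UV p) :
    A₂ p (g, x) = Sum.elim (Pi.single g ((sgnUV p (FreeGroup.of x) : ℤ) - 1))
      (vec (sgnUV p) (FreeGroup.of x) - genSign p g •
        vec (sgnUV p) (uvAct p g (FreeGroup.of x))) := by
  have hχ : FreeGroup.lift (charGen p (-1)) (inclUV p (uvAct p g (FreeGroup.of x))) =
      charGen p (-1) (Sum.inr x) := by
    rw [charGen_inclUV, uvAct, MulEquiv.apply_symm_apply, lift_const_act]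
    rfl
  have hg : ((charGen p (-1) (Sum.inl g) : ℤˣ) : ℤ) = genSign p g := by
    simp only [charGen, Sum.elim_inl, genSign]
    split_ifs <;> simp
  have hx : charGen p (-1) (Sum.inr x) = sgnUV p (FreeGroup.of x) := rfl
  have h1 : A₂ p (g, x) = vec (FreeGroup.lift (charGen p (-1))) (relator p (g, x)) :=
    funext fun z => A₂_apply p (g, x) z
  rw [h1, relator, vec_mul_inv]
  · simp only [vec_mul, vec_inclUV, vec_of, FreeGroup.lift_apply_of, hg, hx]
    ext (i | i)
    · simp [Pi.single_apply]
      split_ifs <;> ring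
    · simp [Pi.single_apply]
  · simp only [map_mul, FreeGroup.lift_apply_of, hχ]
    rw [mul_comm]

/-! ### The linearized braid action at `t = -1` -/

/-- The evaluated Fox vector of the generator `yₖ`. -/
noncomputable def e (p k : ℕ) : Fin (2 * p) → ℤ := vec (sgn p) (y p k)

theorem e_succ (p : ℕ) (i : Fin (2 * p)) : e p (i.val + 1) = Pi.single i 1 := by
  rw [e, y, dif_pos (by omega), vec_of]
  rfl

theorem linearMap_ext_e {p : ℕ} {N : Type*} [AddCommGroup N]
    {f g : (Fin (2 * p) → ℤ) →ₗ[ℤ] N} (h : ∀ k, 1 ≤ k → k ≤ 2 * p → f (e p k) = g (e p k)) :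
    f = g := by
  refine LinearMap.pi_ext' fun i => LinearMap.ext_ring ?_
  have := h (i.val + 1) (by omega) (by omega)
  rw [e_succ] at this
  simpa using this

/-- The linear action of a braid on evaluated Fox vectors. -/
noncomputable def lin {p : ℕ} (β : Braid.Group (2 * p)) :
    (Fin (2 * p) → ℤ) →ₗ[ℤ] (Fin (2 * p) → ℤ) :=
  jac (sgn p) (act β).toMonoidHom

theorem lin_vec {p : ℕ} (β : Braid.Group (2 * p)) (w : FreeGroup (Fin (2 * p))) :
    lin β (vec (sgn p) w) = vec (sgn p) (act β w) :=
  jac_vec (sgn p) (act β).toMonoidHom (sgn p) (sgn_act p β) w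

theorem lin_mul {p : ℕ} (β β' : Braid.Group (2 * p)) (x : Fin (2 * p) → ℤ) :
    lin (β * β') x = lin β' (lin β x) := by
  have h : lin (β * β') = lin β' ∘ₗ lin β := by
    refine linearMap_ext_vec (sgn p) fun w => ?_
    rw [LinearMap.comp_apply, lin_vec, lin_vec, lin_vec]
    simp [act]
  rw [h]
  rfl

theorem lin_one {p : ℕ} (x : Fin (2 * p) → ℤ) : lin (1 : Braid.Group (2 * p)) x = x := by
  have h : lin (1 : Braid.Group (2 * p)) = LinearMap.id := by
    refine linearMap_ext_vec (sgn p) fun w => ?_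
    rw [lin_vec]
    simp [act]
  rw [h]
  rfl

theorem lin_lin_inv {p : ℕ} (β : Braid.Group (2 * p)) (x : Fin (2 * p) → ℤ) :
    lin β (lin β⁻¹ x) = x := by
  rw [← lin_mul, inv_mul_cancel, lin_one]

/-- The sum of the coordinates. -/
noncomputable def coordSum (p : ℕ) : (Fin (2 * p) → ℤ) →ₗ[ℤ] ℤ :=
  Fintype.linearCombination ℤ fun _ => 1

theorem coordSum_e {p k : ℕ} (h1 : 1 ≤ k) (h2 : k ≤ 2 * p) : coordSum p (e p k) = 1 := by
  obtain ⟨k, rfl⟩ := Nat.exists_eq_add_of_le' h1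
  rw [e_succ p ⟨k, by omega⟩, coordSum, Fintype.linearCombination_apply_single]
  simp

/-- The fundamental identity `∑ (∂w/∂yᵢ)(yᵢ - 1) = w - 1`, evaluated at `yᵢ = -1`. -/
theorem coordSum_vec (p : ℕ) (w : FreeGroup (Fin (2 * p))) :
    -2 * coordSum p (vec (sgn p) w) = (sgn p w : ℤ) - 1 := by
  refine crossed_ext (sgn p) (fun w => -2 * coordSum p (vec (sgn p) w))
    (fun w => (sgn p w : ℤ) - 1) ?_ ?_ ?_ w
  · intro v w
    simp only [vec_mul, map_add, map_smul, smul_eq_mul]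
    ring
  · intro v w
    simp only [map_mul, Units.val_mul, smul_eq_mul]
    ring
  · intro x
    simp [vec_of, coordSum, sgn, Fintype.linearCombination_apply_single]

theorem coordSum_lin {p : ℕ} (β : Braid.Group (2 * p)) (x : Fin (2 * p) → ℤ) :
    coordSum p (lin β x) = coordSum p x := by
  have h : coordSum p ∘ₗ lin β = coordSum p := by
    refine linearMap_ext_vec (sgn p) fun w => ?_
    have h1 := coordSum_vec p w
    have h2 := coordSum_vec p (act β w)
    rw [sgn_act] at h2
    rw [LinearMap.comp_apply, lin_vec]
    omega
  exact LinearMap.congr_fun h x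

theorem act_σ_y {p i : ℕ} (h1 : 1 ≤ i) (h2 : i < 2 * p) (k : ℕ) :
    act (σ (2 * p) i) (y p k) = if k = i then y p i * y p (i + 1) * (y p i)⁻¹
      else if k = i + 1 then y p i else y p k := by
  have hσ : act (σ (2 * p) i) = artinAut (2 * p) ⟨i - 1, by omega⟩ := by
    rw [σ, dif_pos ⟨h1, h2⟩]
    simp [act, artin]
  rw [hσ]
  by_cases hk : 1 ≤ k ∧ k ≤ 2 * p
  · rw [y, dif_pos hk, artinAut_of]
    rw [y, dif_pos (by omega), y, dif_pos (by omega)]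
    simp only
    split_ifs <;> first | omega | skip
    · subst k
      have : i - 1 + 1 = i + 1 - 1 := by omega
      simp only [this]
    · rfl
    · rfl
  -- Outside the range `y p k` is `1`, which every automorphism fixes.
  · rw [if_neg (by omega), if_neg (by omega), y, dif_neg hk, map_one]

theorem vec_conj_y {p i : ℕ} (h1 : 1 ≤ i) (h2 : i < 2 * p) :
    vec (sgn p) (y p i * y p (i + 1) * (y p i)⁻¹) = (2 : ℤ) • e p i - e p (i + 1) := by
  have hs : ∀ k, 1 ≤ k → k ≤ 2 * p → sgn p (y p k) = -1 := by
    intro k hk1 hk2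
    rw [y, dif_pos ⟨hk1, hk2⟩]
    simp [sgn]
  rw [vec_mul, vec_mul, vec_inv, map_mul, hs i h1 (by omega), hs (i + 1) (by omega) (by omega)]
  change e p i + ((-1 : ℤˣ) : ℤ) • e p (i + 1) +
    ((-1 * -1 : ℤˣ) : ℤ) • (-(((-1 : ℤˣ) : ℤ) • e p i)) = _
  have u1 : ((-1 : ℤˣ) : ℤ) = -1 := rfl
  have u2 : ((-1 * -1 : ℤˣ) : ℤ) = 1 := rfl
  rw [u1, u2]
  module

/-- The Burau matrix at `t = -1`: conjugating one reflection by another becomes the reflection `b ↦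
2a - b` of colours. -/
theorem lin_σ {p i : ℕ} (h1 : 1 ≤ i) (h2 : i < 2 * p) (k : ℕ) :
    lin (σ (2 * p) i) (e p k) = if k = i then (2 : ℤ) • e p i - e p (i + 1)
      else if k = i + 1 then e p i else e p k := by
  rw [e, lin_vec, act_σ_y h1 h2]
  split_ifs
  · exact vec_conj_y h1 h2
  · rfl
  · rfl

/-- The product `σₐ σₐ₊₂ ⋯` of `n` commuting generators. -/
def row (p a n : ℕ) : Braid.Group (2 * p) :=
  ((List.range n).map fun j => σ (2 * p) (a + 2 * j)).prod

theorem row_succ (p a n : ℕ) : row p a (n + 1) = row p a n * σ (2 * p) (a + 2 * n) := by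
  simp [row, List.range_succ]

theorem lin_row_fixed {p a n k : ℕ} (ha : 1 ≤ a) (hn : a + 2 * n ≤ 2 * p + 1)
    (hk : k < a ∨ a + 2 * n ≤ k) : lin (row p a n) (e p k) = e p k := by
  induction n with
  | zero => simp [row, lin_one]
  | succ n ih =>
    rw [row_succ, lin_mul, ih (by omega) (by omega), lin_σ (by omega) (by omega),
      if_neg (by omega), if_neg (by omega)]

theorem lin_row_left {p a n j : ℕ} (ha : 1 ≤ a) (hn : a + 2 * n ≤ 2 * p + 1) (hj : j < n) :
    lin (row p a n) (e p (a + 2 * j)) = (2 : ℤ) • e p (a + 2 * j) - e p (a + 2 * j + 1) := by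
  induction n with
  | zero => omega
  | succ n ih =>
    rw [row_succ, lin_mul]
    rcases Nat.lt_succ_iff_lt_or_eq.1 hj with h | rfl
    · rw [ih (by omega) h, map_sub, map_smul, lin_σ (by omega) (by omega), if_neg (by omega),
        if_neg (by omega), lin_σ (by omega) (by omega), if_neg (by omega), if_neg (by omega)]
    · rw [lin_row_fixed ha (by omega) (by omega), lin_σ (by omega) (by omega), if_pos rfl]

theorem lin_row_right {p a n j : ℕ} (ha : 1 ≤ a) (hn : a + 2 * n ≤ 2 * p + 1) (hj : j < n) :
    lin (row p a n) (e p (a + 2 * j + 1)) = e p (a + 2 * j) := by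
  induction n with
  | zero => omega
  | succ n ih =>
    rw [row_succ, lin_mul]
    rcases Nat.lt_succ_iff_lt_or_eq.1 hj with h | rfl
    · rw [ih (by omega) h, lin_σ (by omega) (by omega), if_neg (by omega), if_neg (by omega)]
    · rw [lin_row_fixed ha (by omega) (by omega), lin_σ (by omega) (by omega), if_neg (by omega),
        if_pos rfl]

theorem rho₁_eq (p : ℕ) : rho₁ p = (tau p)⁻¹ * row p 1 p * tau p := by
  have h : (fun j => σ (2 * p) (1 + 2 * j)) = fun j => σ (2 * p) (2 * j + 1) :=
    funext fun j => by rw [add_comm]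
  rw [rho₁, row, h]

/-! ### The action of `τ` -/

/-- The product of the last `n` factors of `τ`, the first of which starts with `σₖ₊₂`. -/
def tauSuffix (p k n : ℕ) : Braid.Group (2 * p) :=
  ((List.range n).map fun i => row p (k + i + 2) (p - 1 - (k + i))).prod

theorem tau_eq (p : ℕ) : tau p = tauSuffix p 0 (p - 1) := by
  simp only [tau, tauSuffix, row, zero_add]

theorem tauSuffix_succ (p k n : ℕ) :
    tauSuffix p k (n + 1) = row p (k + 2) (p - 1 - k) * tauSuffix p (k + 1) n := by
  have h : (fun i : ℕ => row p (k + i.succ + 2) (p - 1 - (k + i.succ))) =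
      fun i => row p (k + 1 + i + 2) (p - 1 - (k + 1 + i)) := by
    funext i
    rw [show k + i.succ = k + 1 + i by omega]
  rw [tauSuffix, List.prod_range_succ', h, tauSuffix, add_zero]

/-- The factor starting with `σₖ₊₂` ends with `σ₂ₚ₋ₖ₋₂`, so it moves only the strands from `k + 2`
to `2p - k - 1`; later factors move fewer. -/
theorem lin_tauSuffix_fixed {p n : ℕ} : ∀ {k i : ℕ}, k + n + 1 = p → i ≤ k + 1 ∨ 2 * p - k ≤ i →
    lin (tauSuffix p k n) (e p i) = e p i := by
  induction n with
  | zero => intro k i _ _; simp [tauSuffix, lin_one]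
  | succ n ih =>
    intro k i hk hi
    rw [tauSuffix_succ, lin_mul, lin_row_fixed (by omega) (by omega) (by omega),
      ih (by omega) (by omega)]

/-- Each of the first `j` factors meets this vector as the right strand of a crossing and lowers its
index by one; the factors after that no longer reach it. -/
theorem lin_tauSuffix_odd {p n : ℕ} : ∀ {k j : ℕ}, k + n + 1 = p → j ≤ n →
    lin (tauSuffix p k n) (e p (k + 1 + 2 * j)) = e p (k + 1 + j) := by
  induction n with
  | zero =>
    intro k j _ hj
    obtain rfl : j = 0 := by omega
    simp [tauSuffix, lin_one]
  | succ n ih =>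
    intro k j hk hj
    rcases j with _ | j
    · exact lin_tauSuffix_fixed (by omega) (by omega)
    · have h1 : k + 1 + 2 * (j + 1) = k + 2 + 2 * j + 1 := by ring
      have h2 : k + 2 + 2 * j = k + 1 + 1 + 2 * j := by ring
      have h3 : k + 1 + (j + 1) = k + 1 + 1 + j := by ring
      rw [tauSuffix_succ, lin_mul, h1, lin_row_right (by omega) (by omega) (by omega), h2,
        ih (by omega) (by omega), h3]

/-- The images of the even generators under `τ`, as seen by a functional `ℓ` with the constant
value `c` on the last `p` generators. -/
def tauEven {N : Type*} [AddCommGroup N] (p : ℕ) (ℓ : ℕ → N) (c : N) : ℕ → N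
  | 0 => c
  | m + 1 => (2 : ℤ) • ℓ (p - m) - tauEven p ℓ c m

/-- The first factor turns the vector into `2a - b`, where for the next suffix `a` is of the kind
handled by `lin_tauSuffix_odd` and `b` is again of the present kind with the same `j`. At `j = n`
the vector is `e` with index `2p - k`, which is fixed and carries the value `c`. -/
theorem lin_tauSuffix_even {N : Type*} [AddCommGroup N] {p n : ℕ}
    (ℓ : (Fin (2 * p) → ℤ) →ₗ[ℤ] N) (c : N)
    (hc : ∀ j, p < j → j ≤ 2 * p → ℓ (e p j) = c) : ∀ {k j : ℕ}, k + n + 1 = p → j ≤ n →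
    ℓ (lin (tauSuffix p k n) (e p (k + 2 + 2 * j))) =
      tauEven p (fun i => ℓ (e p i)) c (n - j) := by
  induction n with
  | zero =>
    intro k j hk hj
    obtain rfl : j = 0 := by omega
    rw [lin_tauSuffix_fixed (n := 0) hk (by omega)]
    exact hc _ (by omega) (by omega)
  | succ n ih =>
    intro k j hk hj
    rcases Nat.le_succ_iff_eq_or_le.1 hj with rfl | hj
    · rw [lin_tauSuffix_fixed hk (by omega), Nat.sub_self]
      exact hc _ (by omega) (by omega)
    · have h2 : k + 2 + 2 * j = k + 1 + 1 + 2 * j := by ring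
      have h3 : k + 1 + 1 + 2 * j + 1 = k + 1 + 2 + 2 * j := by ring
      have h4 : n + 1 - j = n - j + 1 := by omega
      have h5 : p - (n - j) = k + 1 + 1 + j := by omega
      rw [tauSuffix_succ, lin_mul, lin_row_left (by omega) (by omega) (by omega), map_sub, map_sub,
        map_smul, map_smul, h2, lin_tauSuffix_odd (by omega) hj, h3, ih (by omega) hj, h4,
        tauEven, h5]

theorem lin_tau_odd {p r : ℕ} (h1 : 1 ≤ r) (h2 : r ≤ p) :
    lin (tau p) (e p (2 * r - 1)) = e p r := by
  have h := lin_tauSuffix_odd (p := p) (n := p - 1) (k := 0) (j := r - 1) (by omega) (by omega)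
  rw [← tau_eq] at h
  convert h using 2 <;> congr 1 <;> omega

theorem lin_tau_even {N : Type*} [AddCommGroup N] {p r : ℕ}
    (ℓ : (Fin (2 * p) → ℤ) →ₗ[ℤ] N) (c : N)
    (hc : ∀ j, p < j → j ≤ 2 * p → ℓ (e p j) = c) (h1 : 1 ≤ r) (h2 : r ≤ p) :
    ℓ (lin (tau p) (e p (2 * r))) = tauEven p (fun i => ℓ (e p i)) c (p - r) := by
  have h := lin_tauSuffix_even (p := p) (n := p - 1) ℓ c hc (k := 0) (j := r - 1) (by omega)
    (by omega)
  rw [← tau_eq] at h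
  convert h using 2
  · congr 2; omega
  · omega

/-! ### The action of `ρ₀` -/

/-- The product `σₘ σₘ₋₁ ⋯ σ₁`. -/
def descent (p m : ℕ) : Braid.Group (2 * p) :=
  ((List.range m).map fun k => σ (2 * p) (m - k)).prod

theorem descent_succ (p m : ℕ) : descent p (m + 1) = σ (2 * p) (m + 1) * descent p m := by
  simp only [descent, List.prod_range_succ', Nat.sub_zero, Nat.succ_eq_add_one,
    Nat.add_sub_add_right]

theorem lin_descent_fixed {p m k : ℕ} (hm : m < 2 * p) (hk : m + 1 < k) :
    lin (descent p m) (e p k) = e p k := by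
  induction m with
  | zero => simp [descent, lin_one]
  | succ m ih =>
    rw [descent_succ, lin_mul, lin_σ (by omega) (by omega), if_neg (by omega), if_neg (by omega),
      ih (by omega) (by omega)]

theorem lin_descent_last {p m : ℕ} (hm : m < 2 * p) :
    lin (descent p m) (e p (m + 1)) = e p 1 := by
  induction m with
  | zero => simp [descent, lin_one]
  | succ m ih =>
    rw [descent_succ, lin_mul, lin_σ (by omega) (by omega), if_neg (by omega), if_pos rfl,
      ih (by omega)]

/-- Nothing happens before `σₖ`, which produces `2eₖ - eₖ₊₁`; the generators after it carry `eₖ`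
down to `e₁` and fix `eₖ₊₁`. -/
theorem lin_descent {p m k : ℕ} (hm : m < 2 * p) (h1 : 1 ≤ k) (hk : k ≤ m) :
    lin (descent p m) (e p k) = (2 : ℤ) • e p 1 - e p (k + 1) := by
  induction m with
  | zero => omega
  | succ m ih =>
    rw [descent_succ, lin_mul, lin_σ (by omega) (by omega)]
    rcases Nat.le_succ_iff_eq_or_le.1 hk with rfl | hk
    · rw [if_pos rfl, map_sub, map_smul, lin_descent_last (by omega),
        lin_descent_fixed (by omega) (by omega)]
    · rw [if_neg (by omega), if_neg (by omega), ih (by omega) hk]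

theorem lin_rho₀_fixed {p k : ℕ} (hp : 1 ≤ p) (hk : p < k) : lin (rho₀ p) (e p k) = e p k :=
  lin_descent_fixed (m := p - 1) (by omega) (by omega)

theorem lin_rho₀_last {p : ℕ} (hp : 1 ≤ p) : lin (rho₀ p) (e p p) = e p 1 := by
  have h := lin_descent_last (p := p) (m := p - 1) (by omega)
  rwa [Nat.sub_add_cancel hp] at h

theorem lin_rho₀ {p k : ℕ} (h1 : 1 ≤ k) (hk : k < p) :
    lin (rho₀ p) (e p k) = (2 : ℤ) • e p 1 - e p (k + 1) :=
  lin_descent (m := p - 1) (by omega) h1 (by omega)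

/-- The vectors of the first `p` generators, indexed periodically from `0`. -/
noncomputable def ePer (p j : ℕ) : Fin (2 * p) → ℤ := e p (j % p + 1)

/-- Periodic indexing makes the case `k = p` uniform with the others, since `2e₁ - e₁ = e₁`. -/
theorem lin_rho₀_ePer {p : ℕ} (hp : 1 ≤ p) (j : ℕ) :
    lin (rho₀ p) (ePer p j) = (2 : ℤ) • ePer p 0 - ePer p (j + 1) := by
  have hj := Nat.mod_lt j (show p > 0 by omega)
  have h0 : ePer p 0 = e p 1 := by simp [ePer]
  rw [h0, ePer, ePer]
  by_cases h : j % p + 1 = p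
  · have h' : (j + 1) % p = 0 := by rw [← Nat.mod_add_mod, h, Nat.mod_self]
    rw [h, h', lin_rho₀_last hp]
    module
  · have h' : (j + 1) % p = j % p + 1 := by
      rw [← Nat.mod_add_mod, Nat.mod_eq_of_lt (by omega)]
    rw [h', lin_rho₀ (by omega) (by omega)]

theorem lin_rho₀_pow_ePer {p : ℕ} (hp : 1 ≤ p) (m : ℕ) : ∀ j,
    lin (rho₀ p ^ m) (ePer p j) =
      (2 : ℤ) • (∑ i ∈ Finset.range m, (-1 : ℤ) ^ i • ePer p i) + (-1 : ℤ) ^ m • ePer p (j + m) := by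
  induction m with
  | zero => intro j; simp [lin_one]
  | succ m ih =>
    intro j
    have h : j + 1 + m = j + (m + 1) := by ring
    rw [pow_succ', lin_mul, lin_rho₀_ePer hp, map_sub, map_smul, ih, ih, Finset.sum_range_succ,
      zero_add, h, pow_succ]
    module

/-- The vector of the product `y₁ ⋯ yₚ`. -/
noncomputable def altSum (p : ℕ) : Fin (2 * p) → ℤ :=
  ∑ i ∈ Finset.range p, (-1 : ℤ) ^ i • e p (i + 1)

/-- The full twist `ρ₀ᵖ` conjugates by `w = y₁ ⋯ yₚ`, which is odd, so the linearization is the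
reflection `x ↦ 2w - x`. In the iteration, the index returns after `p` steps with sign `(-1)ᵖ = -1`.
-/
theorem lin_rho₀_pow_self {p k : ℕ} (hodd : Odd p) (h1 : 1 ≤ k) (hk : k ≤ p) :
    lin (rho₀ p ^ p) (e p k) = (2 : ℤ) • altSum p - e p k := by
  have h := lin_rho₀_pow_ePer (p := p) (by omega) p (k - 1)
  have hs : ∑ i ∈ Finset.range p, (-1 : ℤ) ^ i • ePer p i = altSum p := by
    refine Finset.sum_congr rfl fun i hi => ?_
    rw [ePer, Nat.mod_eq_of_lt (Finset.mem_range.1 hi)]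
  have h0 : ePer p (k - 1) = e p k := by
    rw [ePer, Nat.mod_eq_of_lt (by omega), Nat.sub_add_cancel h1]
  have h2 : ePer p (k - 1 + p) = e p k := by
    rw [← h0, ePer, ePer, Nat.add_mod_right]
  rw [hs, h0, h2, hodd.neg_one_pow] at h
  rw [h]
  module

theorem lin_rho₀_pow_fixed {p k : ℕ} (hp : 1 ≤ p) (hk : p < k) (m : ℕ) :
    lin (rho₀ p ^ m) (e p k) = e p k := by
  induction m with
  | zero => simp [lin_one]
  | succ m ih => rw [pow_succ, lin_mul, ih, lin_rho₀_fixed hp hk]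

/-! ### The dihedral functional -/

/-- The functional `e_k ↦ 2k - 1` for `k ≤ p`, `e_k ↦ 0` for `k > p`. -/
noncomputable def dih (p : ℕ) : (Fin (2 * p) → ℤ) →ₗ[ℤ] ℤ :=
  Fintype.linearCombination ℤ fun i : Fin (2 * p) => if i.val < p then 2 * (i.val : ℤ) + 1 else 0

theorem dih_e {p k : ℕ} (h1 : 1 ≤ k) (h2 : k ≤ p) : dih p (e p k) = 2 * (k : ℤ) - 1 := by
  obtain ⟨k, rfl⟩ := Nat.exists_eq_add_of_le' h1
  rw [e_succ p ⟨k, by omega⟩, dih, Fintype.linearCombination_apply_single, if_pos (by simp only; omega)]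
  push_cast
  simp
  ring

theorem dih_e_of_lt {p k : ℕ} (h1 : p < k) (h2 : k ≤ 2 * p) : dih p (e p k) = 0 := by
  obtain ⟨k, rfl⟩ := Nat.exists_eq_add_of_le' (show 1 ≤ k by omega)
  rw [e_succ p ⟨k, by omega⟩, dih, Fintype.linearCombination_apply_single,
    if_neg (by simp only; omega)]
  simp

/-- The reduction of the dihedral functional modulo `p`. -/
noncomputable def dihMod (p : ℕ) : (Fin (2 * p) → ℤ) →ₗ[ℤ] ZMod p :=
  (Int.castAddHom (ZMod p)).toIntLinearMap ∘ₗ dih p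

theorem dihMod_apply (p : ℕ) (x : Fin (2 * p) → ℤ) : dihMod p x = (dih p x : ZMod p) := rfl

/-- For `k < p` this is the integral identity `2 - (2k + 1) = -(2k - 1)`. Only `eₚ ↦ e₁` needs
reduction modulo `p`, through `1 ≡ -(2p - 1)`. -/
theorem dihMod_rho₀ {p : ℕ} (hp : 1 ≤ p) (x : Fin (2 * p) → ℤ) :
    dihMod p (lin (rho₀ p) x) = -dihMod p x := by
  have h : dihMod p ∘ₗ lin (rho₀ p) = -dihMod p := by
    refine linearMap_ext_e fun k h1 h2 => ?_
    rw [LinearMap.comp_apply, LinearMap.neg_apply]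
    rcases lt_trichotomy k p with hk | rfl | hk
    · rw [lin_rho₀ h1 hk, dihMod_apply, dihMod_apply, map_sub, map_smul, dih_e le_rfl hp,
        dih_e h1 hk.le, dih_e (by omega) hk, smul_eq_mul, ← Int.cast_neg]
      congr 1
      push_cast
      ring
    · rw [lin_rho₀_last hp, dihMod_apply, dihMod_apply, dih_e le_rfl hp, dih_e h1 le_rfl]
      push_cast
      simp
    · rw [lin_rho₀_fixed hp hk, dihMod_apply, dih_e_of_lt hk h2]
      simp
  exact LinearMap.congr_fun h x

theorem dihMod_rho₀_pow {p : ℕ} (hp : 1 ≤ p) (m : ℕ) (x : Fin (2 * p) → ℤ) :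
    dihMod p (lin (rho₀ p ^ m) x) = (-1 : ZMod p) ^ m * dihMod p x := by
  induction m with
  | zero => simp [lin_one]
  | succ m ih => rw [pow_succ, lin_mul, dihMod_rho₀ hp, ih, pow_succ]; ring

/-- The image under `τ` of the vector `e₂ᵣ₋₁ - e₂ᵣ` of the `r`-th half twist of `ρ₁`. -/
noncomputable def arc (p r : ℕ) : Fin (2 * p) → ℤ := lin (tau p) (e p (2 * r - 1) - e p (2 * r))

theorem map_arc {N : Type*} [AddCommGroup N] {p r : ℕ}
    (ℓ : (Fin (2 * p) → ℤ) →ₗ[ℤ] N) (c : N)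
    (hc : ∀ j, p < j → j ≤ 2 * p → ℓ (e p j) = c) (h1 : 1 ≤ r) (h2 : r ≤ p) :
    ℓ (arc p r) = ℓ (e p r) - tauEven p (fun i => ℓ (e p i)) c (p - r) := by
  rw [arc, map_sub, lin_tau_odd h1 h2, map_sub, lin_tau_even ℓ c hc h1 h2]

theorem coordSum_arc {p r : ℕ} (h1 : 1 ≤ r) (h2 : r ≤ p) : coordSum p (arc p r) = 0 := by
  rw [arc, coordSum_lin, map_sub, coordSum_e (by omega) (by omega),
    coordSum_e (by omega) (by omega), sub_self]

/-- The recursion for the even images gives `-2m` modulo `p`, so the arc has value `(2r - 1) + 2(p -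
r) ≡ -1`, independently of `r`. -/
theorem dihMod_arc {p r : ℕ} (h1 : 1 ≤ r) (h2 : r ≤ p) : dihMod p (arc p r) = -1 := by
  have key : ∀ m, m ≤ p →
      tauEven p (fun i => dihMod p (e p i)) 0 m = ((-2 * (m : ℤ) : ℤ) : ZMod p) := by
    intro m
    induction m with
    | zero => intro _; simp [tauEven]
    | succ m ih =>
      intro hm
      rw [tauEven, ih (by omega), dihMod_apply, dih_e (by omega) (by omega),
        Nat.cast_sub (by omega)]
      push_cast
      simp
      ring
  rw [map_arc (dihMod p) 0 _ h1 h2, key _ (by omega), dihMod_apply, dih_e h1 h2, Nat.cast_sub h2]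
  · push_cast
    simp
  · intro j hj1 hj2
    rw [dihMod_apply, dih_e_of_lt hj1 hj2, Int.cast_zero]

/-- Consecutive differences of arcs give second differences of the first `p` vectors. -/
theorem second_difference {N : Type*} [AddCommGroup N] {p r : ℕ}
    (ℓ : (Fin (2 * p) → ℤ) →ₗ[ℤ] N) (c : N)
    (hc : ∀ j, p < j → j ≤ 2 * p → ℓ (e p j) = c) (h1 : 1 ≤ r) (h2 : r + 2 ≤ p)
    (h : ℓ (arc p r) = ℓ (arc p (r + 2))) :
    ℓ (e p r) - (2 : ℤ) • ℓ (e p (r + 1)) + ℓ (e p (r + 2)) = 0 := by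
  have e1 : p - r = p - (r + 2) + 1 + 1 := by omega
  have e2 : p - (p - (r + 2)) = r + 2 := by omega
  have e3 : p - (p - (r + 2) + 1) = r + 1 := by omega
  rw [map_arc ℓ c hc h1 (by omega), map_arc ℓ c hc (by omega) h2, e1, tauEven, tauEven, e2, e3] at h
  rw [← sub_eq_zero] at h
  rw [← h]
  module

/-! ### The row lattice -/

theorem zsmul_eq_zsmul_of_cast_eq {Q : Type*} [AddCommGroup Q] {p : ℕ} {δ : Q}
    (hδ : (p : ℤ) • δ = 0) {a b : ℤ} (h : (a : ZMod p) = (b : ZMod p)) : a • δ = b • δ := by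
  obtain ⟨t, ht⟩ := (ZMod.intCast_eq_intCast_iff_dvd_sub a b p).1 h
  have hb : b = a + t * p := by linarith
  rw [hb, add_smul, mul_smul, hδ, smul_zero, add_zero]

/-- After the first term, the terms pair off and each pair contributes `2d`. -/
theorem sum_alternating {Q : Type*} [AddCommGroup Q] (x d : Q) (m : ℕ) :
    ∑ i ∈ Finset.range (2 * m + 1), (-1 : ℤ) ^ i • (x + (2 * (i : ℤ) + 1) • d) =
      x + (2 * (m : ℤ) + 1) • d := by
  induction m with
  | zero => simp
  | succ m ih =>
    rw [show 2 * (m + 1) + 1 = 2 * m + 1 + 1 + 1 by ring, Finset.sum_range_succ,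
      Finset.sum_range_succ, ih, (show Odd (2 * m + 1) from ⟨m, rfl⟩).neg_one_pow,
      (show Even (2 * m + 1 + 1) from ⟨m + 1, by ring⟩).neg_one_pow]
    push_cast
    module

/-- A functional on the linearized free group that kills the lattice relations is determined by
the coordinate sum and the dihedral functional. -/
theorem exists_dihedral_form {Q : Type*} [AddCommGroup Q] {p : ℕ} (hodd : Odd p) (hp : 3 ≤ p)
    (ℓ : (Fin (2 * p) → ℤ) →ₗ[ℤ] Q) (c : Q)
    (hc : ∀ j, p < j → j ≤ 2 * p → ℓ (e p j) = c) (hs : ℓ (altSum p) = c)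
    (h0 : ∀ r, 1 ≤ r → r ≤ p → ℓ (arc p r) = ℓ (arc p p))
    (h1 : ∀ r, 1 ≤ r → r ≤ p → ℓ (lin (rho₀ p) (arc p r)) = ℓ (lin (rho₀ p) (arc p p))) :
    ∃ δ : Q, (p : ℤ) • δ = 0 ∧ ∀ z, ℓ z = coordSum p z • c + dih p z • δ := by
  set E := ℓ (e p 1) with hE
  set D := ℓ (e p 2) - ℓ (e p 1) with hD
  -- Equal arc values make second differences vanish. Two consecutive values are carried along, as
  -- the recursion has order two.
  have harith : ∀ i, i + 1 < p → ℓ (e p (i + 1)) = E + (i : ℤ) • D ∧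
      ℓ (e p (i + 2)) = E + ((i : ℤ) + 1) • D := by
    intro i
    induction i with
    | zero => intro _; simp [hE, hD]
    | succ i ih =>
      intro hi
      obtain ⟨ih1, ih2⟩ := ih (by omega)
      have h := second_difference ℓ c hc (r := i + 1) (by omega) (by omega)
        ((h0 _ (by omega) (by omega)).trans (h0 _ (by omega) (by omega)).symm)
      rw [show i + 1 + 1 = i + 2 by ring, ih1, ih2] at h
      refine ⟨by rw [show i + 1 + 1 = i + 2 by ring, ih2]; push_cast; rfl, ?_⟩
      rw [eq_neg_of_add_eq_zero_right h]
      push_cast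
      module
  have harith' : ∀ k, 1 ≤ k → k ≤ p → ℓ (e p k) = E + ((k : ℤ) - 1) • D := by
    intro k hk1 hk2
    rcases hk2.lt_or_eq with hk | rfl
    · obtain ⟨i, rfl⟩ := Nat.exists_eq_add_of_le' hk1
      rw [(harith i hk).1]
      push_cast
      module
    · obtain ⟨i, rfl⟩ := Nat.exists_eq_add_of_le' (show 2 ≤ k by omega)
      rw [(harith i (by omega)).2]
      push_cast
      module
  -- The rotated functional takes the values `2E - ℓ(eₖ₊₁)` for `k < p` and `E` at `k = p`; its
  -- second difference at `p - 2`, across the seam, equals `p D`.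
  have hD0 : (p : ℤ) • D = 0 := by
    have h := second_difference (ℓ ∘ₗ lin (rho₀ p)) c
      (fun j hj1 hj2 => by rw [LinearMap.comp_apply, lin_rho₀_fixed (by omega) hj1, hc j hj1 hj2])
      (r := p - 2) (by omega) (by omega)
      ((h1 _ (by omega) (by omega)).trans (h1 _ (by omega) (by omega)).symm)
    simp only [LinearMap.comp_apply] at h
    rw [show p - 2 + 1 = p - 1 by omega, show p - 2 + 2 = p by omega, lin_rho₀_last (by omega),
      lin_rho₀ (by omega) (by omega), lin_rho₀ (by omega) (by omega),
      show p - 2 + 1 = p - 1 by omega, show p - 1 + 1 = p by omega, map_sub, map_sub, map_smul,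
      harith' 1 le_rfl (by omega), harith' (p - 1) (by omega) (by omega),
      harith' p (by omega) le_rfl, Nat.cast_sub (by omega)] at h
    rw [← h]
    push_cast
    module
  obtain ⟨m, hm⟩ := hodd
  -- With `p = 2m + 1`, the factor `m + 1` is an inverse of `2` modulo `p`.
  set δ := ((m : ℤ) + 1) • D with hδ
  have h2δ : (2 : ℤ) • δ = D := by
    have h : (2 : ℤ) • δ = D + (p : ℤ) • D := by
      rw [hδ, hm]
      push_cast
      module
    rw [h, hD0, add_zero]
  have hpδ : (p : ℤ) • δ = 0 := by rw [hδ, smul_comm, hD0, smul_zero]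
  have hform : ∀ k, 1 ≤ k → k ≤ p → ℓ (e p k) = (E - δ) + (2 * (k : ℤ) - 1) • δ := by
    intro k hk1 hk2
    rw [harith' k hk1 hk2, ← h2δ]
    module
  -- The alternating sum of the progression is `(E - δ) + p δ`, and `p δ` vanishes.
  have hcE : c = E - δ := by
    have h : ∀ i ∈ Finset.range p, ℓ ((-1 : ℤ) ^ i • e p (i + 1)) =
        (-1 : ℤ) ^ i • ((E - δ) + (2 * (i : ℤ) + 1) • δ) := by
      intro i hi
      rw [map_smul, hform _ (by omega) (Finset.mem_range.1 hi)]
      push_cast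
      module
    have hp' : (2 * (m : ℤ) + 1) = p := by rw [hm]; push_cast; ring
    rw [← hs, altSum, map_sum, Finset.sum_congr rfl h]
    nth_rewrite 1 [hm]
    rw [sum_alternating, hp', hpδ, add_zero]
  refine ⟨δ, hpδ, fun z => ?_⟩
  have h : ℓ = (coordSum p).smulRight c + (dih p).smulRight δ := by
    refine linearMap_ext_e fun k hk1 hk2 => ?_
    rw [LinearMap.add_apply, LinearMap.smulRight_apply, LinearMap.smulRight_apply,
      coordSum_e hk1 hk2, one_smul]
    rcases le_or_gt k p with hk | hk
    · rw [hform k hk1 hk, dih_e hk1 hk, hcE]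
    · rw [hc k hk hk2, dih_e_of_lt hk hk2, zero_smul, add_zero]
  rw [h]
  rfl

/-! ### Rows attached to a single `γ`. -/

/-- The rows of the relators `x γ = γ · γ(x)` for a fixed `γ`, as a function of the Fox vector
of `x`, in coordinates changed by `τ`. -/
noncomputable def block (p : ℕ) (g : Fin (p + 1)) :
    (Fin (2 * p) → ℤ) →ₗ[ℤ] (Fin (p + 1) → ℤ) × (Fin (2 * p) → ℤ) :=
  ((-2 : ℤ) • (coordSum p).smulRight (Pi.single g 1)).prod
    (LinearMap.id - genSign p g • lin (monodromy p g))

theorem block_apply (p : ℕ) (g : Fin (p + 1)) (z : Fin (2 * p) → ℤ) :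
    block p g z = ((-2 : ℤ) • coordSum p z • Pi.single g 1,
      z - genSign p g • lin (monodromy p g) z) := rfl

theorem block_zero_of_le {p k : ℕ} (hodd : Odd p) (h1 : 1 ≤ k) (h2 : k ≤ p) :
    block p 0 (e p k) = (2 : ℤ) • (-Pi.single 0 1, altSum p) := by
  rw [block_apply, coordSum_e h1 (by omega), genSign, if_pos rfl, monodromy, if_pos rfl,
    lin_rho₀_pow_self hodd h1 h2, Prod.smul_mk]
  congr 1 <;> module

theorem block_zero_of_lt {p k : ℕ} (hp : 1 ≤ p) (h1 : p < k) (h2 : k ≤ 2 * p) :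
    block p 0 (e p k) = (2 : ℤ) • (-Pi.single 0 1, e p k) := by
  rw [block_apply, coordSum_e (by omega) h2, genSign, if_pos rfl, monodromy, if_pos rfl,
    lin_rho₀_pow_fixed hp h1, Prod.smul_mk]
  congr 1 <;> module

/-- The monodromy of `γ₁₂:ᵣ` is the square of `σ₁σ₃ ⋯ σ₂ₚ₋₁` conjugated by `τ ρ₀^(p-r)`, so on
vectors transported by that braid it acts as the square does. -/
theorem lin_monodromy {p : ℕ} {g : Fin (p + 1)} (hg : g ≠ 0) (x : Fin (2 * p) → ℤ) :
    lin (monodromy p g) (lin (rho₀ p ^ (p - g.val)) (lin (tau p) x)) =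
      lin (rho₀ p ^ (p - g.val)) (lin (tau p) (lin (row p 1 p) (lin (row p 1 p) x))) := by
  have h : tau p * rho₀ p ^ (p - g.val) * monodromy p g =
      row p 1 p * row p 1 p * tau p * rho₀ p ^ (p - g.val) := by
    have hk : ((p : ℤ) - g.val) = ((p - g.val : ℕ) : ℤ) := by omega
    have hk' : ((g.val : ℤ) - p) = -((p - g.val : ℕ) : ℤ) := by omega
    rw [monodromy, if_neg hg, hk, hk', zpow_neg, zpow_natCast, rho₁_eq]
    simp only [pow_two, mul_assoc, mul_inv_cancel_left]
  have h' := congrArg (fun β => lin β x) h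
  simpa only [lin_mul] using h'

theorem lin_row_row_left {p r : ℕ} (h1 : 1 ≤ r) (h2 : r ≤ p) :
    lin (row p 1 p) (lin (row p 1 p) (e p (2 * r - 1))) =
      e p (2 * r - 1) + (2 : ℤ) • (e p (2 * r - 1) - e p (2 * r)) := by
  obtain ⟨r, rfl⟩ := Nat.exists_eq_add_of_le' h1
  rw [show 2 * (r + 1) - 1 = 1 + 2 * r by omega, show 2 * (r + 1) = 1 + 2 * r + 1 by omega,
    lin_row_left le_rfl (by omega) (by omega), map_sub, map_smul,
    lin_row_left le_rfl (by omega) (by omega), lin_row_right le_rfl (by omega) (by omega)]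
  module

theorem lin_row_row_right {p r : ℕ} (h1 : 1 ≤ r) (h2 : r ≤ p) :
    lin (row p 1 p) (lin (row p 1 p) (e p (2 * r))) =
      e p (2 * r) + (2 : ℤ) • (e p (2 * r - 1) - e p (2 * r)) := by
  obtain ⟨r, rfl⟩ := Nat.exists_eq_add_of_le' h1
  rw [show 2 * (r + 1) - 1 = 1 + 2 * r by omega, show 2 * (r + 1) = 1 + 2 * r + 1 by omega,
    lin_row_right le_rfl (by omega) (by omega), lin_row_left le_rfl (by omega) (by omega)]
  module

/-- The squared crossing of strands `2r - 1` and `2r` adds the same vector `2(e₂ᵣ₋₁ - e₂ᵣ)` to both,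
so the two strands give the same row. -/
theorem block_of_ne_zero {p k r : ℕ} {g : Fin (p + 1)} (hg : g ≠ 0) (h1 : 1 ≤ r) (h2 : r ≤ p)
    (hk : k = 2 * r - 1 ∨ k = 2 * r) :
    block p g (lin (rho₀ p ^ (p - g.val)) (lin (tau p) (e p k))) =
      (2 : ℤ) • -(Pi.single g 1, lin (rho₀ p ^ (p - g.val)) (arc p r)) := by
  have hrow : lin (row p 1 p) (lin (row p 1 p) (e p k)) =
      e p k + (2 : ℤ) • (e p (2 * r - 1) - e p (2 * r)) := by
    rcases hk with rfl | rfl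
    · exact lin_row_row_left h1 h2
    · exact lin_row_row_right h1 h2
  rw [block_apply, lin_monodromy hg, hrow, coordSum_lin, coordSum_lin,
    coordSum_e (by omega) (by omega), genSign, if_neg hg, arc]
  simp only [map_add, map_smul, Prod.neg_mk, Prod.smul_mk]
  congr 1 <;> module

theorem sgn_basisEquiv_act (p : ℕ) (w : FreeGroup (UV p)) :
    sgn p ((basisEquiv p).trans (act (tau p)) w) = sgnUV p w := sgn_act p _ _

/-- The change of coordinates from the generators `uᵣ`, `vᵣ` to the images of the `yᵢ`
under `τ`. -/
noncomputable def uvCoords (p : ℕ) : (UV p → ℤ) ≃ₗ[ℤ] (Fin (2 * p) → ℤ) :=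
  jacEquiv (sgn p) (sgnUV p) ((basisEquiv p).trans (act (tau p))) (sgn_basisEquiv_act p)

theorem uvCoords_vec (p : ℕ) (w : FreeGroup (UV p)) :
    uvCoords p (vec (sgnUV p) w) = lin (tau p) (vec (sgn p) (basisEquiv p w)) := by
  rw [lin_vec]
  exact jacEquiv_vec _ _ _ _ _

/-- The change of coordinates for the columns of the Alexander matrix. -/
noncomputable def coords (p : ℕ) :
    (Gen p → ℤ) ≃ₗ[ℤ] (Fin (p + 1) → ℤ) × (Fin (2 * p) → ℤ) :=
  LinearEquiv.sumArrowLequivProdArrow (Fin (p + 1)) (UV p) ℤ ℤ ≪≫ₗ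
    LinearEquiv.prodCongr (LinearEquiv.refl ℤ _) (uvCoords p)

theorem coords_elim (p : ℕ) (f : Fin (p + 1) → ℤ) (h : UV p → ℤ) :
    coords p (Sum.elim f h) = (f, uvCoords p h) := rfl

/-- Following the action by `τ` cancels the `τ⁻¹` in `τ η(γ) τ⁻¹`; what remains is `η(γ)` applied to
the transported vector. -/
theorem coords_row (p : ℕ) (g : Fin (p + 1)) (x : UV p) :
    coords p (A₂ p (g, x)) =
      block p g (lin (tau p) (vec (sgn p) (basisEquiv p (FreeGroup.of x)))) := by
  rw [A₂_row, coords_elim, block_apply, map_sub, map_smul, uvCoords_vec, uvCoords_vec,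
    coordSum_lin, smul_smul, coordSum_vec]
  congr 1
  · ext i
    simp [Pi.single_apply, sgnUV]
  · rw [uvAct, MulEquiv.apply_symm_apply]
    simp only [← lin_vec, ← lin_mul, monodromyConj, inv_mul_cancel_right]

theorem map_coords_range (p : ℕ) :
    (LinearMap.range (A₂ p).vecMulLinear).map (coords p).toLinearMap =
      ⨆ g, LinearMap.range (block p g) := by
  rw [range_vecMulLinear, Submodule.map_span]
  apply le_antisymm
  · rw [Submodule.span_le]
    rintro _ ⟨_, ⟨⟨g, x⟩, rfl⟩, rfl⟩
    refine Submodule.mem_iSup_of_mem g ?_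
    exact ⟨_, (coords_row p g x).symm⟩
  · refine iSup_le fun g => ?_
    rintro _ ⟨z, rfl⟩
    obtain ⟨c, rfl⟩ := (uvCoords p).surjective z
    have hc : c ∈ Submodule.span ℤ (Set.range (Pi.basisFun ℤ (UV p))) := by
      rw [(Pi.basisFun ℤ (UV p)).span_eq]; trivial
    induction hc using Submodule.span_induction with
    | mem c hc =>
      obtain ⟨x, rfl⟩ := hc
      rw [Pi.basisFun_apply, ← vec_of (sgnUV p), uvCoords_vec]
      exact Submodule.subset_span ⟨_, ⟨(g, x), rfl⟩, coords_row p g x⟩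
    | zero => simp
    | add a b _ _ ha hb => rw [map_add, map_add]; exact Submodule.add_mem _ ha hb
    | smul t a _ ha => rw [map_smul, map_smul]; exact Submodule.smul_mem _ t ha

/-! ### The lattice of half rows and the functionals that define it. -/

/-- The first functional cutting out the row lattice. -/
noncomputable def degree (p : ℕ) : (Fin (p + 1) → ℤ) × (Fin (2 * p) → ℤ) →ₗ[ℤ] ℤ :=
  (Fintype.linearCombination ℤ fun g : Fin (p + 1) => if g = 0 then (1 : ℤ) else 0).coprod
    (coordSum p)

/-- The second functional cutting out the row lattice. -/
noncomputable def twist (p : ℕ) : (Fin (p + 1) → ℤ) × (Fin (2 * p) → ℤ) →ₗ[ℤ] ℤ :=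
  (Fintype.linearCombination ℤ fun g : Fin (p + 1) =>
    if g = 0 then (0 : ℤ) else (-1) ^ (p - g.val)).coprod (dih p)

theorem degree_single (p : ℕ) (g : Fin (p + 1)) (z : Fin (2 * p) → ℤ) :
    degree p (Pi.single g 1, z) = (if g = 0 then 1 else 0) + coordSum p z := by
  simp [degree, Fintype.linearCombination_apply_single]

theorem twist_single (p : ℕ) (g : Fin (p + 1)) (z : Fin (2 * p) → ℤ) :
    twist p (Pi.single g 1, z) = (if g = 0 then 0 else (-1) ^ (p - g.val)) + dih p z := by
  simp [twist, Fintype.linearCombination_apply_single]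

/-- The lattice of half the rows. -/
noncomputable def halfLattice (p : ℕ) :
    Submodule ℤ ((Fin (p + 1) → ℤ) × (Fin (2 * p) → ℤ)) :=
  LinearMap.ker (degree p) ⊓
    LinearMap.ker ((Int.castAddHom (ZMod p)).toIntLinearMap ∘ₗ twist p)

theorem mem_halfLattice {p : ℕ} {x : (Fin (p + 1) → ℤ) × (Fin (2 * p) → ℤ)} :
    x ∈ halfLattice p ↔ degree p x = 0 ∧ ((twist p x : ℤ) : ZMod p) = 0 := Iff.rfl

theorem coordSum_altSum {p : ℕ} (hodd : Odd p) : coordSum p (altSum p) = 1 := by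
  obtain ⟨m, hm⟩ := hodd
  have h : ∀ i ∈ Finset.range p, coordSum p ((-1 : ℤ) ^ i • e p (i + 1)) =
      (-1 : ℤ) ^ i • ((1 : ℤ) + (2 * (i : ℤ) + 1) • (0 : ℤ)) := by
    intro i hi
    have := Finset.mem_range.1 hi
    rw [map_smul, coordSum_e (by omega) (by omega), smul_zero, add_zero]
  rw [altSum, map_sum, Finset.sum_congr rfl h]
  nth_rewrite 1 [hm]
  rw [sum_alternating, smul_zero, add_zero]

theorem dih_altSum {p : ℕ} (hodd : Odd p) : dih p (altSum p) = p := by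
  obtain ⟨m, hm⟩ := hodd
  have h : ∀ i ∈ Finset.range p, dih p ((-1 : ℤ) ^ i • e p (i + 1)) =
      (-1 : ℤ) ^ i • ((0 : ℤ) + (2 * (i : ℤ) + 1) • (1 : ℤ)) := by
    intro i hi
    have := Finset.mem_range.1 hi
    rw [map_smul, dih_e (by omega) (by omega)]
    push_cast
    simp only [smul_eq_mul]
    ring
  rw [altSum, map_sum, Finset.sum_congr rfl h]
  nth_rewrite 1 [hm]
  rw [sum_alternating, hm]
  push_cast
  simp

theorem single_zero_altSum_mem {p : ℕ} (hodd : Odd p) :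
    ((-Pi.single 0 1, altSum p) : (Fin (p + 1) → ℤ) × (Fin (2 * p) → ℤ)) ∈ halfLattice p := by
  have h : ((-Pi.single 0 1, altSum p) : (Fin (p + 1) → ℤ) × (Fin (2 * p) → ℤ)) =
      -(Pi.single 0 1, -altSum p) := by simp
  rw [h, neg_mem_iff, mem_halfLattice, degree_single, twist_single, map_neg, map_neg,
    coordSum_altSum hodd, dih_altSum hodd]
  simp

theorem single_zero_e_mem {p k : ℕ} (h1 : p < k) (h2 : k ≤ 2 * p) :
    ((-Pi.single 0 1, e p k) : (Fin (p + 1) → ℤ) × (Fin (2 * p) → ℤ)) ∈ halfLattice p := by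
  have h : ((-Pi.single 0 1, e p k) : (Fin (p + 1) → ℤ) × (Fin (2 * p) → ℤ)) =
      -(Pi.single 0 1, -e p k) := by simp
  rw [h, neg_mem_iff, mem_halfLattice, degree_single, twist_single, map_neg, map_neg,
    coordSum_e (by omega) h2, dih_e_of_lt h1 h2]
  simp

/-- The sign `(-1)^(p-g)` in `twist` cancels the dihedral value `-(-1)^(p-g)` of the arc rotated by
`ρ₀^(p-g)`. -/
theorem single_arc_mem {p r : ℕ} {g : Fin (p + 1)} (hg : g ≠ 0) (h1 : 1 ≤ r) (h2 : r ≤ p) :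
    ((Pi.single g 1, lin (rho₀ p ^ (p - g.val)) (arc p r)) :
      (Fin (p + 1) → ℤ) × (Fin (2 * p) → ℤ)) ∈ halfLattice p := by
  rw [mem_halfLattice, degree_single, twist_single, if_neg hg, if_neg hg, coordSum_lin,
    coordSum_arc h1 h2, Int.cast_add, ← dihMod_apply, dihMod_rho₀_pow (by omega),
    dihMod_arc h1 h2]
  simp

theorem exists_half_index {k p : ℕ} (h1 : 1 ≤ k) (h2 : k ≤ 2 * p) :
    ∃ r, 1 ≤ r ∧ r ≤ p ∧ (k = 2 * r - 1 ∨ k = 2 * r) :=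
  ⟨(k + 1) / 2, by omega, by omega, by omega⟩

theorem range_block_le {p : ℕ} (hodd : Odd p) (g : Fin (p + 1)) :
    LinearMap.range (block p g) ≤
      (halfLattice p).map (LinearMap.lsmul ℤ ((Fin (p + 1) → ℤ) × (Fin (2 * p) → ℤ)) 2) := by
  set K := (halfLattice p).map (LinearMap.lsmul ℤ ((Fin (p + 1) → ℤ) × (Fin (2 * p) → ℤ)) 2)
  have hp : 1 ≤ p := hodd.pos
  have hK : ∀ x ∈ halfLattice p, K.mkQ ((2 : ℤ) • x) = 0 := fun x hx =>
    (Submodule.Quotient.mk_eq_zero K).2 ⟨x, hx, rfl⟩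
  have key : K.mkQ ∘ₗ block p g = 0 := by
    by_cases hg : g = 0
    · subst hg
      refine linearMap_ext_e fun k h1 h2 => ?_
      rw [LinearMap.comp_apply, LinearMap.zero_apply]
      rcases le_or_gt k p with hk | hk
      · rw [block_zero_of_le hodd h1 hk]
        exact hK _ (single_zero_altSum_mem hodd)
      · rw [block_zero_of_lt hp hk h2]
        exact hK _ (single_zero_e_mem hk h2)
    -- The rows are computed on the images of the `eₖ` under `τ` followed by `ρ₀^(p-g)`; these still
    -- span because braids act invertibly.
    · have h : K.mkQ ∘ₗ block p g ∘ₗ lin (rho₀ p ^ (p - g.val)) ∘ₗ lin (tau p) = 0 := by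
        refine linearMap_ext_e fun k h1 h2 => ?_
        obtain ⟨r, hr1, hr2, hk⟩ := exists_half_index h1 h2
        simp only [LinearMap.comp_apply, LinearMap.zero_apply]
        rw [block_of_ne_zero hg hr1 hr2 hk]
        exact hK _ (neg_mem (single_arc_mem hg hr1 hr2))
      refine LinearMap.ext fun x => ?_
      have h' := LinearMap.congr_fun h (lin (tau p)⁻¹ (lin (rho₀ p ^ (p - g.val))⁻¹ x))
      simp only [LinearMap.comp_apply, lin_lin_inv] at h'
      exact h'
  rintro _ ⟨z, rfl⟩
  exact (Submodule.Quotient.mk_eq_zero K).1 (LinearMap.congr_fun key z)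

/-- In the quotient by all `x` whose double is a combination of rows, the computed rows become
relations. They force the quotient map to factor through `degree` and `twist` modulo `p`. -/
theorem two_smul_mem_of_mem_halfLattice {p : ℕ} (hodd : Odd p) (hp : 3 ≤ p)
    {x : (Fin (p + 1) → ℤ) × (Fin (2 * p) → ℤ)} (hx : x ∈ halfLattice p) :
    (2 : ℤ) • x ∈ ⨆ g, LinearMap.range (block p g) := by
  set S := (⨆ g, LinearMap.range (block p g)).comap
    (LinearMap.lsmul ℤ ((Fin (p + 1) → ℤ) × (Fin (2 * p) → ℤ)) 2) with hS
  have hblock : ∀ g z y, block p g z = (2 : ℤ) • y → S.mkQ y = 0 := by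
    intro g z y h
    refine (Submodule.Quotient.mk_eq_zero S).2 ?_
    exact Submodule.mem_iSup_of_mem g ⟨z, h⟩
  let γ : Fin (p + 1) → _ ⧸ S := fun g => S.mkQ (Pi.single g 1, 0)
  let ℓ : (Fin (2 * p) → ℤ) →ₗ[ℤ] _ ⧸ S := S.mkQ ∘ₗ LinearMap.inr ℤ _ _
  have hsplit : ∀ g z, S.mkQ (Pi.single g 1, z) = γ g + ℓ z := by
    intro g z
    change _ = S.mkQ (Pi.single g 1, 0) + S.mkQ (0, z)
    rw [← map_add]
    simp
  have hsplit' : ∀ g z, S.mkQ (-Pi.single g 1, z) = -γ g + ℓ z := by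
    intro g z
    change _ = -S.mkQ (Pi.single g 1, 0) + S.mkQ (0, z)
    rw [← map_neg, ← map_add]
    simp
  have hfix : ∀ j, p < j → j ≤ 2 * p → ℓ (e p j) = γ 0 := by
    intro j h1 h2
    have h := hblock 0 _ _ (block_zero_of_lt (by omega) h1 h2)
    rw [hsplit'] at h
    exact (neg_add_eq_zero.1 h).symm
  have halt : ℓ (altSum p) = γ 0 := by
    have h := hblock 0 _ _ (block_zero_of_le hodd le_rfl (by omega))
    rw [hsplit'] at h
    exact (neg_add_eq_zero.1 h).symm
  have harc : ∀ g : Fin (p + 1), g ≠ 0 → ∀ r, 1 ≤ r → r ≤ p →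
      ℓ (lin (rho₀ p ^ (p - g.val)) (arc p r)) = -γ g := by
    intro g hg r h1 h2
    have h := hblock g _ _ (block_of_ne_zero hg h1 h2 (Or.inr rfl))
    rw [map_neg, neg_eq_zero, hsplit] at h
    exact eq_neg_of_add_eq_zero_right h
  -- Only the last two generators are needed for the form of `ℓ`: `γ₁₂:ₚ` gives the arcs themselves
  -- and `γ₁₂:ₚ₋₁` the arcs rotated once. The others then merely determine the classes `γ g`.
  have harc0 : ∀ r, 1 ≤ r → r ≤ p → ℓ (arc p r) = ℓ (arc p p) := by
    have h : ∀ r, 1 ≤ r → r ≤ p → ℓ (arc p r) = -γ (Fin.last p) := by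
      intro r h1 h2
      have := harc (Fin.last p) (by rw [Ne, Fin.ext_iff]; simp; omega) r h1 h2
      simpa [lin_one] using this
    exact fun r h1 h2 => (h r h1 h2).trans (h p (by omega) le_rfl).symm
  have harc1 : ∀ r, 1 ≤ r → r ≤ p → ℓ (lin (rho₀ p) (arc p r)) = ℓ (lin (rho₀ p) (arc p p)) := by
    have h : ∀ r, 1 ≤ r → r ≤ p → ℓ (lin (rho₀ p) (arc p r)) = -γ ⟨p - 1, by omega⟩ := by
      intro r h1 h2
      have := harc ⟨p - 1, by omega⟩ (by rw [Ne, Fin.ext_iff]; simp; omega) r h1 h2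
      simpa [show p - (p - 1) = 1 by omega] using this
    exact fun r h1 h2 => (h r h1 h2).trans (h p (by omega) le_rfl).symm
  obtain ⟨δ, hδ, hform⟩ := exists_dihedral_form hodd hp ℓ (γ 0) hfix halt harc0 harc1
  have hγ : ∀ g : Fin (p + 1), g ≠ 0 → γ g = ((-1 : ℤ) ^ (p - g.val)) • δ := by
    intro g hg
    have h := harc g hg p (by omega) le_rfl
    rw [hform, coordSum_lin, coordSum_arc (by omega) le_rfl, zero_smul, zero_add,
      zsmul_eq_zsmul_of_cast_eq hδ (b := -(-1) ^ (p - g.val)), neg_smul, neg_inj] at h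
    · exact h.symm
    · rw [← dihMod_apply, dihMod_rho₀_pow (by omega), dihMod_arc (by omega) le_rfl]
      push_cast
      ring
  -- The class of each generator is now expressed by `γ 0` and `δ`, and the coefficients are those
  -- of `degree` and `twist`.
  have hmk : S.mkQ = (degree p).smulRight (γ 0) + (twist p).smulRight δ := by
    refine LinearMap.prod_ext ?_ ?_
    · refine LinearMap.pi_ext' fun g => LinearMap.ext_ring ?_
      change S.mkQ (Pi.single g 1, 0) = degree p (Pi.single g 1, 0) • γ 0 +
        twist p (Pi.single g 1, 0) • δ
      rw [degree_single, twist_single, map_zero, map_zero, add_zero, add_zero]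
      by_cases hg : g = 0
      · subst hg
        rw [if_pos rfl, if_pos rfl, one_smul, zero_smul, add_zero]
      · rw [if_neg hg, if_neg hg, zero_smul, zero_add]
        exact hγ g hg
    · refine LinearMap.ext fun z => ?_
      change ℓ z = degree p (0, z) • γ 0 + twist p (0, z) • δ
      rw [hform]
      simp [degree, twist]
  obtain ⟨h1, h2⟩ := mem_halfLattice.1 hx
  have hx0 : S.mkQ x = 0 := by
    rw [hmk, LinearMap.add_apply, LinearMap.smulRight_apply, LinearMap.smulRight_apply, h1,
      zero_smul, zero_add, zsmul_eq_zsmul_of_cast_eq hδ (b := 0) (by rw [h2, Int.cast_zero]),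
      zero_smul]
  exact (Submodule.Quotient.mk_eq_zero S).1 hx0

theorem mem_range_iff {p : ℕ} (hodd : Odd p) (hp : 3 ≤ p) (y : Gen p → ℤ) :
    y ∈ LinearMap.range (A₂ p).vecMulLinear ↔
      ∃ x, y = (2 : ℤ) • x ∧ degree p (coords p x) = 0 ∧ (p : ℤ) ∣ twist p (coords p x) := by
  have hy : y ∈ LinearMap.range (A₂ p).vecMulLinear ↔
      coords p y ∈ ⨆ g, LinearMap.range (block p g) := by
    rw [← map_coords_range]
    constructor
    · exact fun h => ⟨y, h, rfl⟩
    · rintro ⟨z, hz, h⟩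
      rwa [← (coords p).injective h]
  rw [hy]
  constructor
  · intro h
    obtain ⟨x, hx, hxy⟩ := iSup_le (range_block_le hodd) h
    obtain ⟨h1, h2⟩ := mem_halfLattice.1 hx
    refine ⟨(coords p).symm x, ?_, ?_, ?_⟩
    · apply (coords p).injective
      rw [map_smul, LinearEquiv.apply_symm_apply, ← hxy]
      rfl
    · rwa [LinearEquiv.apply_symm_apply]
    · rw [LinearEquiv.apply_symm_apply]
      exact (ZMod.intCast_zmod_eq_zero_iff_dvd _ p).1 h2
  · rintro ⟨x, rfl, h1, h2⟩
    rw [map_smul]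
    exact two_smul_mem_of_mem_halfLattice hodd hp
      (mem_halfLattice.2 ⟨h1, (ZMod.intCast_zmod_eq_zero_iff_dvd _ p).2 h2⟩)

end DeletedMonomial

/-! ### The Smith normal form. -/

theorem mainTheorem9 (p : ℕ) (hp : p.Prime) (hodd : Odd p) :
    HasSmithNormalForm (DeletedMonomial.A₂ p)
      (List.replicate (3 * p - 1) 2 ++ [2 * (p : ℤ)]) := by
  have hp3 : 3 ≤ p := by
    have := hp.two_le
    have : p ≠ 2 := by rintro rfl; exact absurd hodd (by decide)
    omega
  have hlast : Fin.last p ≠ 0 := by rw [Ne, Fin.ext_iff]; simp; omega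
  -- Unimodularity is witnessed by `γ₁`, of degree `1`, and by `γ₁₂:ₚ`, of degree `0` and twist
  -- `(-1)⁰ = 1`. There are `3p + 1` columns, two more than the number of entries `2`.
  refine hasSmithNormalForm_of_range (DeletedMonomial.A₂ p) p (3 * p - 1) hp.pos ?_ ?_
    (DeletedMonomial.degree p ∘ₗ (DeletedMonomial.coords p).toLinearMap)
    (DeletedMonomial.twist p ∘ₗ (DeletedMonomial.coords p).toLinearMap)
    ((DeletedMonomial.coords p).symm (Pi.single 0 1, 0))
    ((DeletedMonomial.coords p).symm (Pi.single (Fin.last p) 1, 0)) ?_ ?_ ?_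
    (DeletedMonomial.mem_range_iff hodd hp3)
  · simp only [Fintype.card_prod, Fintype.card_sum, Fintype.card_fin]
    nlinarith [Nat.sub_add_cancel (show 1 ≤ 3 * p by omega)]
  · simp only [Fintype.card_sum, Fintype.card_fin]
    omega
  · simp [DeletedMonomial.degree_single]
  · simp [DeletedMonomial.twist_single, hlast]
  · simp [DeletedMonomial.degree_single, hlast]
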